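/- Let $(X,d)$ be a metric space with a Borel measure $\mu$, and write $B(x,r)=\{y: d(x,y)<r\}$, $V(x,r)=\mu(B(x,r))$. Assume that $(X,d,\mu)$ is a space of homogeneous type of dimension $n>0$: $0<V(x,r)<\infty$ and $V(x,\lambda r)\le A\lambda^{n}V(x,r)$ for all $x\in X$, $r>0$, $\lambda\ge 1$, with a constant $A>0$. Let $L$ be a non-negative self-adjoint operator on $L^2(X,\mu)$ (complex-valued functions), with functions $F(L)$ defined by the spectral theorem, and for $E\subseteq X$ let $P_Ef=\chi_Ef$. Let $m\ge 2$ be real and suppose that $L$ satisfies the $m$-th order Davies–Gaffney estimates $$\big\|P_{B(x,t^{1/m})}\,e^{-tL}\,P_{B(y,t^{1/m})}\big\|_{2\to2}\le b\,\exp\Big(-a\Big(\frac{d(x,y)}{t^{1/m}}\Big)^{\frac{m}{m-1}}\Big)\qquad\text{for all } t>0,\ x,y\in X,$$ with constants $a,b>0$. Let $\phi\in C^\infty(\mathbb R)$ (complex-valued) have support in $[1/4,4]$. Then for every real $M>0$ and every integer $K\ge1$ there is a constant $C>0$, depending only on $M,K,m,\phi$, on $n,A$, and on $a,b$ (in particular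 independent of $t$, $s$, $k$, of the balls, and otherwise of $X$, $\mu$ and $L$), such that for all $s>0$, $t\in\mathbb R$, all integers $k\ge1$, all $c\ge 1/4$, all balls $B_1=B(x_1,r)$, $B_2=B(x_2,r)$ in $X$ of equal radius $r\ge c\,2^{(m-1)k/m}(1+|t|)$, and all $f\in L^2(X,\mu)$, $$\big\|P_{B_1}(I-e^{-sL})^{K}e^{itL}\phi(2^{-k}L)P_{B_2}f\big\|_2\le C\Big(1+\frac{d(B_1,B_2)}{2^{(m-1)k/m}(1+|t|)}\Big)^{-M}\|P_{B_2}f\|_2,$$ where $d(B_1,B_2)=\inf\{d(x,y):x\in B_1,\ y\in B_2\}$. -/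

import Mathlib

open MeasureTheory Set
open scoped ENNReal

universe u

noncomputable section

/-! ### Projection-valued measures and the Borel functional calculus -/

section Spectral

variable {H : Type*} [NormedAddCommGroup H] [InnerProductSpace ℂ H] [CompleteSpace H]

/-- A projection-valued measure on the Borel subsets of `ℝ`, acting on the complex Hilbert space
`H`. (The values of `proj` on non-measurable sets are irrelevant.) -/
structure ProjectionValuedMeasure (H : Type*) [NormedAddCommGroup H] [InnerProductSpace ℂ H]
    [CompleteSpace H] where
  /-- The projection attached to a set. -/
  proj : Set ℝ → (H →L[ℂ] H)
  isStarProjection : ∀ S, MeasurableSet S → IsStarProjection (proj S)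
  proj_univ : proj univ = 1
  proj_inter : ∀ S T, MeasurableSet S → MeasurableSet T → proj (S ∩ T) = proj S * proj T
  hasSum_proj : ∀ S : ℕ → Set ℝ, (∀ i, MeasurableSet (S i)) →
    Pairwise (fun i j => Disjoint (S i) (S j)) →
    ∀ f : H, HasSum (fun i => proj (S i) f) (proj (⋃ i, S i) f)

namespace ProjectionValuedMeasure

open Classical in
/-- The projection-valued point mass at `0`. -/
instance : Inhabited (ProjectionValuedMeasure H) where
  default :=
    { proj := fun S => if (0 : ℝ) ∈ S then 1 else 0
      isStarProjection := by
        intro S _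
        split_ifs
        · exact IsStarProjection.one _
        · exact IsStarProjection.zero _
      proj_univ := by simp
      proj_inter := by
        intro S T _ _
        by_cases hS : (0 : ℝ) ∈ S <;> by_cases hT : (0 : ℝ) ∈ T <;> simp [hS, hT]
      hasSum_proj := by
        intro S _ hd f
        by_cases h : ∃ i, (0 : ℝ) ∈ S i
        · obtain ⟨i, hi⟩ := h
          have h1 : (0 : ℝ) ∈ ⋃ i, S i := mem_iUnion.2 ⟨i, hi⟩
          have h2 := hasSum_single (f := fun j => (if (0 : ℝ) ∈ S j then (1 : H →L[ℂ] H) else 0) f)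
            i (fun j hj => by
              have : (0 : ℝ) ∉ S j := fun h0 => Set.disjoint_left.1 (hd hj) h0 hi
              simp [this])
          simpa [h1, hi] using h2
        · have h1 : (0 : ℝ) ∉ ⋃ i, S i := by simpa using h
          have h2 : ∀ i, (0 : ℝ) ∉ S i := by simpa using h
          simp only [h1, h2, if_false]
          simp }

variable (E : ProjectionValuedMeasure H)

theorem inner_proj {S : Set ℝ} (hS : MeasurableSet S) (f : H) :
    inner ℂ f (E.proj S f) = ((‖E.proj S f‖ ^ 2 : ℝ) : ℂ) := by
  have hi : E.proj S (E.proj S f) = E.proj S f := by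
    simpa using congrArg (fun T : H →L[ℂ] H => T f) (E.isStarProjection S hS).isIdempotentElem.eq
  have hs := ContinuousLinearMap.isSelfAdjoint_iff_isSymmetric.1
    (E.isStarProjection S hS).isSelfAdjoint
  have h1 := hs f (E.proj S f)
  simp only [ContinuousLinearMap.coe_coe] at h1
  rw [hi] at h1
  rw [← h1, inner_self_eq_norm_sq_to_K]
  push_cast
  rfl

/-- The scalar spectral measure `S ↦ ⟨f, E(S) f⟩ = ‖E(S) f‖²` of the vector `f`. -/
def scalarMeasure (f : H) : Measure ℝ :=
  Measure.ofMeasurable (fun S _ => ENNReal.ofReal (‖E.proj S f‖ ^ 2))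
    (by
      have h := E.hasSum_proj (fun _ => ∅) (fun _ => MeasurableSet.empty)
        (fun _ _ _ => disjoint_bot_left) f
      have h0 : E.proj ∅ f = 0 := by
        have := h.summable
        rwa [summable_const_iff] at this
      simp [h0])
    (by
      intro S hS hd
      have h1 : HasSum (fun i => ‖E.proj (S i) f‖ ^ 2) (‖E.proj (⋃ i, S i) f‖ ^ 2) := by
        have h := (innerSL ℂ f).hasSum (E.hasSum_proj S hS (fun i j hij => hd hij) f)
        simp only [innerSL_apply_apply] at h
        rw [E.inner_proj (MeasurableSet.iUnion hS)] at h
        have h' := Complex.reCLM.hasSum h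
        simp only [Complex.reCLM_apply, Complex.ofReal_re] at h'
        refine (funext fun i => ?_ : (fun i => ‖E.proj (S i) f‖ ^ 2) = _) ▸ h'
        rw [E.inner_proj (hS i), Complex.ofReal_re]
      rw [← h1.tsum_eq, ENNReal.ofReal_tsum_of_nonneg (fun _ => sq_nonneg _) h1.summable])

theorem scalarMeasure_apply {S : Set ℝ} (hS : MeasurableSet S) (f : H) :
    E.scalarMeasure f S = ENNReal.ofReal (‖E.proj S f‖ ^ 2) :=
  Measure.ofMeasurable_apply S hS

open Classical in
/-- The operator `∫ F(λ) dE(λ)` of a bounded Borel function `F`: the unique (by polarization)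
bounded operator `T` with `⟨f, T f⟩ = ∫ F(λ) d⟨f, E(λ) f⟩` for all `f`. -/
def integral (F : ℝ → ℂ) : H →L[ℂ] H :=
  if h : ∃ T : H →L[ℂ] H, ∀ f : H, inner ℂ f (T f) = ∫ l, F l ∂(E.scalarMeasure f)
  then h.choose else 0

/-- `E` is the spectral resolution of the operator `L`, that is, `L = ∫ λ dE(λ)`: the domain of `L`
consists of all `f` with `∫ λ² d⟨f, E(λ) f⟩ < ∞`, and `⟨f, L f⟩ = ∫ λ d⟨f, E(λ) f⟩` there (which
determines `L f` by polarization, the domain being dense). -/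
structure IsResolutionOf (L : H →ₗ.[ℂ] H) : Prop where
  mem_domain_iff : ∀ f : H,
    f ∈ L.domain ↔ ∫⁻ l, ENNReal.ofReal (l ^ 2) ∂(E.scalarMeasure f) < ∞
  inner_apply : ∀ f : L.domain,
    inner ℂ (f : H) (L f) = ((∫ l, l ∂(E.scalarMeasure (f : H)) : ℝ) : ℂ)

end ProjectionValuedMeasure

open Classical in
/-- The spectral resolution `E_L` of a self-adjoint operator `L` (it exists and is unique on Borel
sets by the spectral theorem). -/
def spectralResolution (L : H →ₗ.[ℂ] H) : ProjectionValuedMeasure H :=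
  if h : ∃ E : ProjectionValuedMeasure H, E.IsResolutionOf L then h.choose else default

/-- The bounded Borel functional calculus `F(L) = ∫ F(λ) dE_L(λ)`. -/
def borelCalc (L : H →ₗ.[ℂ] H) (F : ℝ → ℂ) : H →L[ℂ] H :=
  (spectralResolution L).integral F

/-- The heat semigroup `e^{-tL}`. -/
def heatSemigroup (L : H →ₗ.[ℂ] H) (t : ℝ) : H →L[ℂ] H :=
  borelCalc L (fun l => Complex.exp (-(t * l : ℝ)))

/-- The Schrödinger group `e^{itL}`. -/
def schrodingerGroup (L : H →ₗ.[ℂ] H) (t : ℝ) : H →L[ℂ] H :=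
  borelCalc L (fun l => Complex.exp (Complex.I * (t * l : ℝ)))

/-- `L` is non-negative: `⟨L f, f⟩ ≥ 0` on its domain. -/
def IsNonnegOperator (L : H →ₗ.[ℂ] H) : Prop :=
  ∀ f : L.domain, 0 ≤ (inner ℂ (L f) (f : H)).re

end Spectral

/-! ### Restriction operators on `L²` -/

section Restriction

variable {X : Type*} [MeasurableSpace X]

/-- The linear map `f ↦ χ_S f` on `L²(X, μ)`. -/
def restrictLinear (μ : Measure X) {S : Set X} (hS : MeasurableSet S) :
    Lp ℂ 2 μ →ₗ[ℂ] Lp ℂ 2 μ where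
  toFun f := ((Lp.memLp f).indicator hS).toLp (S.indicator f)
  map_add' := by
    intro f g
    rw [← MemLp.toLp_add, MemLp.toLp_eq_toLp_iff]
    filter_upwards [Lp.coeFn_add f g] with x hx
    by_cases h : x ∈ S
    · simp only [Pi.add_apply, indicator_of_mem h]
      exact hx
    · simp only [Pi.add_apply, indicator_of_notMem h, add_zero]
  map_smul' := by
    intro c f
    rw [RingHom.id_apply, ← MemLp.toLp_const_smul, MemLp.toLp_eq_toLp_iff]
    filter_upwards [Lp.coeFn_smul c f] with x hx
    by_cases h : x ∈ S
    · simp only [Pi.smul_apply, indicator_of_mem h]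
      exact hx
    · simp only [Pi.smul_apply, indicator_of_notMem h, smul_zero]

theorem restrictLinear_coeFn (μ : Measure X) {S : Set X} (hS : MeasurableSet S) (f : Lp ℂ 2 μ) :
    (restrictLinear μ hS f : X → ℂ) =ᵐ[μ] S.indicator f := by
  have h : restrictLinear μ hS f = ((Lp.memLp f).indicator hS).toLp (S.indicator f) := rfl
  rw [h]
  exact MemLp.coeFn_toLp _

theorem norm_restrictLinear_le (μ : Measure X) {S : Set X} (hS : MeasurableSet S)
    (f : Lp ℂ 2 μ) : ‖restrictLinear μ hS f‖ ≤ 1 * ‖f‖ := by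
  rw [one_mul]
  apply Lp.norm_le_norm_of_ae_le
  filter_upwards [restrictLinear_coeFn μ hS f] with x hx
  rw [hx]
  exact norm_indicator_le_norm_self _ _

/-- The operator `P_S f = χ_S f` on `L²(X, μ)`. -/
def restrictProj (μ : Measure X) {S : Set X} (hS : MeasurableSet S) :
    Lp ℂ 2 μ →L[ℂ] Lp ℂ 2 μ :=
  (restrictLinear μ hS).mkContinuous 1 (norm_restrictLinear_le μ hS)

end Restriction

/-! ### Metric measure spaces -/

section MetricMeasure

variable {X : Type*} [MetricSpace X] [MeasurableSpace X]

/-- `(X, d, μ)` is a space of homogeneous type of dimension `n`, with constant `A`: balls have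
positive finite measure and `V(x, λ r) ≤ A λ^n V(x, r)` for `λ ≥ 1`. (For `λ = 2` this is the
doubling property; conversely doubling with constant `C` gives it for some `A` and `n`.) -/
structure IsHomogeneousType (μ : Measure X) (n A : ℝ) : Prop where
  ball_pos : ∀ (x : X) (r : ℝ), 0 < r → 0 < μ (Metric.ball x r)
  ball_lt_top : ∀ (x : X) (r : ℝ), 0 < r → μ (Metric.ball x r) < ∞
  ball_le : ∀ (x : X) (r : ℝ), 0 < r → ∀ l : ℝ, 1 ≤ l →
    μ (Metric.ball x (l * r)) ≤ ENNReal.ofReal (A * l ^ n) * μ (Metric.ball x r)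

/-- The distance `d(S, T) = inf {d(x, y) : x ∈ S, y ∈ T}` of two nonempty sets. -/
def setDist (S T : Set X) : ℝ := sInf (Set.image2 dist S T)

variable [BorelSpace X]

/-- The operator `P_{B(x,r)}` on `L²(X, μ)`. -/
def ballProj (μ : Measure X) (x : X) (r : ℝ) : Lp ℂ 2 μ →L[ℂ] Lp ℂ 2 μ :=
  restrictProj μ (S := Metric.ball x r) measurableSet_ball

/-- The `m`-th order Davies–Gaffney estimates for `e^{-tL}`, with constants `b` and `a`:
`‖P_{B(x,t^{1/m})} e^{-tL} P_{B(y,t^{1/m})}‖_{2→2} ≤ b exp(-a (d(x,y)/t^{1/m})^{m/(m-1)})`. -/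
def DaviesGaffney (μ : Measure X) (L : Lp ℂ 2 μ →ₗ.[ℂ] Lp ℂ 2 μ) (m b a : ℝ) : Prop :=
  ∀ (t : ℝ), 0 < t → ∀ x y : X,
    ‖ballProj μ x (t ^ (1 / m)) * heatSemigroup L t * ballProj μ y (t ^ (1 / m))‖ ≤
      b * Real.exp (-(a * (dist x y / t ^ (1 / m)) ^ (m / (m - 1))))

end MetricMeasure

end

/-!
The multiplier estimate is reduced to the heat semigroup at complex times, where the Davies–Gaffney
bounds survive.

Write `τ = 2⁻ᵏ`, `p = m / (m - 1)` and let `D` be the distance of the two balls. Expanding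
`(1 - e^{-sL})^K` by the binomial theorem leaves the multipliers `e^{-jsλ} e^{itλ} φ(τλ)` with
`j ≥ 0`. With `σ = js/τ` and `g(λ) = e^{(1-σ)λ} φ(λ)`, Fourier inversion for `g` gives
`e^{-jsL} e^{itL} φ(τL) = ∫ ĝ(ξ) e^{-z(ξ)L} dξ` with `z(ξ) = τ - i(t + 2πτξ)`. Integration by parts
shows that `ĝ` decays faster than any power, uniformly in `σ ≥ 0`
(`exists_fourier_superposition`), because `e^{(1-σ)λ}` is bounded on the support of `φ`.

It remains to estimate `P_E e^{-zL} P_F`. At real times the Davies–Gaffney bounds between balls of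
radius `t^{1/m}` extend to arbitrary bounded sets: one cuts the sets into cells around a separated
net and applies Schur's test, the row sums being controlled by the volume growth
(`IsHomogeneousType.norm_restrictProj_mul_le`). The result is decay like `exp(-c D^p t^{-1/(m-1)})`,
and the Phragmén–Lindelöf principle in the variable `w = 1/z`, with the comparison function
`exp(κ i (-i w)^{1/(m-1)})`, carries it over to `exp(-c D^p Re z / |z|^p)` for complex times
(`norm_le_exp_of_re_pos`, `norm_inner_complexHeat_le`). At `z = z(ξ)` this is at most a constant
times `((1 + |ξ|) / (1 + D / (τ^{-1/p} (1 + |t|))))^N`, which is integrated against `|ĝ|`.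

The bounded functional calculus of a projection-valued measure is built from its values on simple
functions. The spectral measure enters only through its vanishing on `(-∞, 0)`
(`spectralResolution_proj_Iio_zero`): for the resolution of a non-negative operator this follows by
testing non-negativity on the ranges of the projections of `[-(j+1), -1/(j+1)]`, and the point mass
at `0` has this property as well, so that no separate discussion of the existence of a resolution
is needed.
-/

/-! ### Bounded functional calculus of a projection-valued measure -/

section FunctionalCalculus

variable {H : Type*} [NormedAddCommGroup H] [InnerProductSpace ℂ H]

theorem inner_map_polarization_right (T : H →L[ℂ] H) (g f : H) :
    inner ℂ g (T f) =
      (inner ℂ (g + f) (T (g + f)) - inner ℂ (g - f) (T (g - f))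
        - Complex.I * inner ℂ (g + Complex.I • f) (T (g + Complex.I • f))
        + Complex.I * inner ℂ (g - Complex.I • f) (T (g - Complex.I • f))) / 4 := by
  simp only [map_add, map_sub, map_smul, inner_add_left, inner_add_right, inner_sub_left,
    inner_sub_right, inner_smul_left, inner_smul_right, Complex.conj_I]
  ring_nf
  simp only [Complex.I_sq]
  ring

theorem ContinuousLinearMap.ext_inner_self {S T : H →L[ℂ] H}
    (h : ∀ f, inner ℂ f (S f) = inner ℂ f (T f)) : S = T := by
  ext f
  refine ext_inner_left ℂ fun g => ?_
  rw [inner_map_polarization_right, inner_map_polarization_right T]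
  simp only [h]

/-- An operator is bounded by twice the constant `B` in a bound of its sesquilinear form by
`B (‖g‖² + ‖f‖²)`; the choice `g = (‖f‖ / ‖T f‖) T f` balances the two terms. -/
theorem ContinuousLinearMap.opNorm_le_of_norm_inner_le {T : H →L[ℂ] H} {B : ℝ} (hB : 0 ≤ B)
    (key : ∀ g f, ‖inner ℂ g (T f)‖ ≤ B * (‖g‖ ^ 2 + ‖f‖ ^ 2)) : ‖T‖ ≤ 2 * B := by
  refine T.opNorm_le_bound (by positivity) fun f => ?_
  rcases eq_or_ne (‖T f‖) 0 with h0 | h0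
  · rw [h0]; positivity
  have h1 := key (((‖f‖ / ‖T f‖ : ℝ) : ℂ) • T f) f
  rw [inner_smul_left, norm_mul, RCLike.norm_conj, norm_smul, inner_self_eq_norm_sq_to_K] at h1
  have hp : 0 < ‖T f‖ := lt_of_le_of_ne (norm_nonneg _) (Ne.symm h0)
  simp only [Complex.norm_real, Real.norm_eq_abs, abs_of_nonneg (div_nonneg (norm_nonneg f) hp.le),
    Complex.coe_algebraMap, norm_pow, abs_norm] at h1
  have h2 : ‖f‖ / ‖T f‖ * ‖T f‖ = ‖f‖ := div_mul_cancel₀ _ h0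
  rw [h2, sq ‖T f‖, ← mul_assoc, h2] at h1
  rcases eq_or_ne (‖f‖) 0 with hf | hf
  · rw [norm_eq_zero.1 hf, map_zero]; simp
  have hfp : 0 < ‖f‖ := lt_of_le_of_ne (norm_nonneg _) (Ne.symm hf)
  nlinarith

/-- The operator norm is at most twice the numerical radius. -/
theorem ContinuousLinearMap.opNorm_le_of_norm_inner_self_le {T : H →L[ℂ] H} {B : ℝ} (hB : 0 ≤ B)
    (h : ∀ f, ‖inner ℂ f (T f)‖ ≤ B * ‖f‖ ^ 2) : ‖T‖ ≤ 2 * B := by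
  refine ContinuousLinearMap.opNorm_le_of_norm_inner_le hB fun g f => ?_
  rw [inner_map_polarization_right, norm_div]
  have h1 := parallelogram_law_with_norm ℂ g f
  have h2 := parallelogram_law_with_norm ℂ g (Complex.I • f)
  rw [norm_smul, Complex.norm_I, one_mul] at h2
  have e1 := h (g + f)
  have e2 := h (g - f)
  have e3 := h (g + Complex.I • f)
  have e4 := h (g - Complex.I • f)
  have n4 : ‖(4 : ℂ)‖ = 4 := by norm_num
  rw [n4, div_le_iff₀ (by norm_num)]
  refine (norm_add_le _ _).trans ?_
  refine (add_le_add (norm_sub_le _ _) le_rfl).trans ?_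
  refine (add_le_add (add_le_add (norm_sub_le _ _) le_rfl) le_rfl).trans ?_
  rw [norm_mul, norm_mul, Complex.norm_I, one_mul, one_mul]
  nlinarith [congrArg (fun r => B * r) h1, congrArg (fun r => B * r) h2]

/-- A bounded measurable function is a uniform limit of simple functions. -/
theorem exists_simpleFunc_uniform_approx {F : ℝ → ℂ} (hF : Measurable F) {B : ℝ}
    (hB : ∀ l, ‖F l‖ ≤ B) :
    ∃ G : ℕ → SimpleFunc ℝ ℂ, ∀ n l, ‖F l - G n l‖ ≤ 2 / ((n : ℝ) + 1) := by
  have hre : Measurable fun l => (F l).re := Complex.measurable_re.comp hF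
  have him : Measurable fun l => (F l).im := Complex.measurable_im.comp hF
  -- round real and imaginary parts down to multiples of `1 / (n + 1)`
  let q : ℕ → ℝ → ℤ × ℤ := fun n l => (⌊((n : ℝ) + 1) * (F l).re⌋, ⌊((n : ℝ) + 1) * (F l).im⌋)
  have hq : ∀ n, Measurable (q n) := fun n =>
    (Int.measurable_floor.comp (hre.const_mul _)).prodMk
      (Int.measurable_floor.comp (him.const_mul _))
  let e : ℕ → ℤ × ℤ → ℂ := fun n p => ⟨(p.1 : ℝ) / (n + 1), (p.2 : ℝ) / (n + 1)⟩
  have hfin : ∀ n, (range (q n)).Finite := by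
    intro n
    refine (Set.finite_Icc ((⌊-((n : ℝ) + 1) * B⌋, ⌊-((n : ℝ) + 1) * B⌋) : ℤ × ℤ)
      (⌊((n : ℝ) + 1) * B⌋, ⌊((n : ℝ) + 1) * B⌋)).subset ?_
    rintro _ ⟨l, rfl⟩
    have h1 := abs_le.1 ((Complex.abs_re_le_norm (F l)).trans (hB l))
    have h2 := abs_le.1 ((Complex.abs_im_le_norm (F l)).trans (hB l))
    have hn : (0 : ℝ) < (n : ℝ) + 1 := by positivity
    refine ⟨⟨Int.floor_le_floor ?_, Int.floor_le_floor ?_⟩,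
      ⟨Int.floor_le_floor ?_, Int.floor_le_floor ?_⟩⟩ <;> nlinarith
  refine ⟨fun n =>
    { toFun := fun l => e n (q n l)
      measurableSet_fiber' := fun x => ?_
      finite_range' := ?_ }, fun n l => ?_⟩
  · exact hq n (t := e n ⁻¹' {x}) (MeasurableSet.of_discrete)
  · rw [show (fun l => e n (q n l)) = e n ∘ q n from rfl, range_comp]
    exact (hfin n).image _
  · have hn : (0 : ℝ) < (n : ℝ) + 1 := by positivity
    have hfl : ∀ x : ℝ, |x - (⌊((n : ℝ) + 1) * x⌋ : ℝ) / (n + 1)| ≤ 1 / ((n : ℝ) + 1) := by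
      intro x
      have h1 := Int.floor_le (((n : ℝ) + 1) * x)
      have h2 := Int.lt_floor_add_one (((n : ℝ) + 1) * x)
      have h3 : x - (⌊((n : ℝ) + 1) * x⌋ : ℝ) / (n + 1)
          = (((n : ℝ) + 1) * x - ⌊((n : ℝ) + 1) * x⌋) / (n + 1) := by field_simp
      rw [h3, abs_div, abs_of_pos hn, abs_of_nonneg (by linarith)]
      gcongr
      linarith
    refine (Complex.norm_le_abs_re_add_abs_im _).trans ?_
    have := add_le_add (hfl (F l).re) (hfl (F l).im)
    rw [← add_div, one_add_one_eq_two] at this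
    exact this

variable [CompleteSpace H]

namespace ProjectionValuedMeasure

variable (E : ProjectionValuedMeasure H)

theorem scalarMeasure_univ (f : H) : E.scalarMeasure f univ = ENNReal.ofReal (‖f‖ ^ 2) := by
  rw [E.scalarMeasure_apply MeasurableSet.univ, E.proj_univ]
  simp

instance isFiniteMeasure_scalarMeasure (f : H) : IsFiniteMeasure (E.scalarMeasure f) :=
  ⟨by rw [E.scalarMeasure_univ]; exact ENNReal.ofReal_lt_top⟩

theorem scalarMeasure_real_univ (f : H) : (E.scalarMeasure f).real univ = ‖f‖ ^ 2 := by
  rw [measureReal_def, E.scalarMeasure_univ, ENNReal.toReal_ofReal (sq_nonneg _)]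

/-- The operator `T` is the spectral integral `∫ F dE`. As in the definition of `integral`, only the
diagonal of the sesquilinear form is prescribed, which determines `T` by polarization; the notion
separates existence of the integral from the choice of a value for divergent ones. -/
noncomputable def Represents (F : ℝ → ℂ) (T : H →L[ℂ] H) : Prop :=
  ∀ f : H, inner ℂ f (T f) = ∫ l, F l ∂(E.scalarMeasure f)

variable {E}

theorem Represents.integral_eq {F : ℝ → ℂ} {T : H →L[ℂ] H} (h : E.Represents F T) :
    E.integral F = T := by
  have hex : ∃ T : H →L[ℂ] H, ∀ f : H, inner ℂ f (T f) = ∫ l, F l ∂(E.scalarMeasure f) := ⟨T, h⟩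
  rw [integral, dif_pos hex]
  exact ContinuousLinearMap.ext_inner_self fun f => by rw [hex.choose_spec f, h f]

theorem Represents.congr {F G : ℝ → ℂ} {T : H →L[ℂ] H} (h : E.Represents F T)
    (hFG : ∀ f, F =ᵐ[E.scalarMeasure f] G) : E.Represents G T := fun f => by
  rw [h f]; exact integral_congr_ae (hFG f)

theorem integrable_of_bounded {F : ℝ → ℂ} (hF : Measurable F) {B : ℝ} {f : H}
    (hB : ∀ᵐ l ∂(E.scalarMeasure f), ‖F l‖ ≤ B) : Integrable F (E.scalarMeasure f) :=
  Integrable.of_bound hF.aestronglyMeasurable B hB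

theorem Represents.add {F G : ℝ → ℂ} {S T : H →L[ℂ] H} (hF : E.Represents F S)
    (hG : E.Represents G T) (hFi : ∀ f, Integrable F (E.scalarMeasure f))
    (hGi : ∀ f, Integrable G (E.scalarMeasure f)) :
    E.Represents (fun l => F l + G l) (S + T) := fun f => by
  rw [_root_.add_apply, inner_add_right, hF f, hG f, integral_add (hFi f) (hGi f)]

theorem Represents.sub {F G : ℝ → ℂ} {S T : H →L[ℂ] H} (hF : E.Represents F S)
    (hG : E.Represents G T) (hFi : ∀ f, Integrable F (E.scalarMeasure f))
    (hGi : ∀ f, Integrable G (E.scalarMeasure f)) :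
    E.Represents (fun l => F l - G l) (S - T) := fun f => by
  rw [_root_.sub_apply, inner_sub_right, hF f, hG f, integral_sub (hFi f) (hGi f)]

theorem represents_indicator {S : Set ℝ} (hS : MeasurableSet S) (c : ℂ) :
    E.Represents (S.indicator fun _ => c) (c • E.proj S) := fun f => by
  rw [_root_.smul_apply, inner_smul_right, E.inner_proj hS, integral_indicator hS,
    setIntegral_const, measureReal_def, E.scalarMeasure_apply hS,
    ENNReal.toReal_ofReal (sq_nonneg _), Complex.real_smul, mul_comm]

theorem Represents.norm_le {F : ℝ → ℂ} {T : H →L[ℂ] H} (h : E.Represents F T) {B : ℝ}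
    (hB0 : 0 ≤ B) (hB : ∀ f, ∀ᵐ l ∂(E.scalarMeasure f), ‖F l‖ ≤ B) : ‖T‖ ≤ 2 * B := by
  refine ContinuousLinearMap.opNorm_le_of_norm_inner_self_le hB0 fun f => ?_
  rw [h f, ← E.scalarMeasure_real_univ]
  exact norm_integral_le_of_norm_le_const (hB f)

theorem integrable_simpleFunc (G : SimpleFunc ℝ ℂ) (f : H) :
    Integrable G (E.scalarMeasure f) :=
  G.integrable_of_isFiniteMeasure

theorem exists_represents_simpleFunc (G : SimpleFunc ℝ ℂ) :
    ∃ T, E.Represents (G : ℝ → ℂ) T := by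
  induction G using SimpleFunc.induction with
  | const c hs =>
    refine ⟨_, (represents_indicator hs c).congr fun f => Filter.Eventually.of_forall fun l => ?_⟩
    simp [SimpleFunc.coe_piecewise, Set.piecewise, Set.indicator]
  | add _ hF hG =>
    obtain ⟨S, hS⟩ := hF
    obtain ⟨T, hT⟩ := hG
    exact ⟨S + T, hS.add hT (integrable_simpleFunc _) (integrable_simpleFunc _)⟩

theorem Represents.mul_simpleFunc {F G : SimpleFunc ℝ ℂ} {S T : H →L[ℂ] H}
    (hF : E.Represents F S) (hG : E.Represents G T) :
    E.Represents (fun l => F l * G l) (S * T) := by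
  have hu : ∀ {F : ℝ → ℂ} {S S' : H →L[ℂ] H}, E.Represents F S → E.Represents F S' → S = S' :=
    fun h h' => h.integral_eq.symm.trans h'.integral_eq
  induction F using SimpleFunc.induction generalizing S with
  | @const c s hs =>
    have e1 : S = c • E.proj s := hu hF ((represents_indicator hs c).congr fun f =>
      Filter.Eventually.of_forall fun l => by
        simp [SimpleFunc.coe_piecewise, Set.piecewise, Set.indicator])
    induction G using SimpleFunc.induction generalizing T with
    | @const d t ht =>
      have e2 : T = d • E.proj t := hu hG ((represents_indicator ht d).congr fun f =>
        Filter.Eventually.of_forall fun l => by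
          simp [SimpleFunc.coe_piecewise, Set.piecewise, Set.indicator])
      have e3 : S * T = (c * d) • E.proj (s ∩ t) := by
        rw [e1, e2, E.proj_inter s t hs ht, smul_mul_smul_comm]
      rw [e3]
      refine (represents_indicator (hs.inter ht) (c * d)).congr fun f =>
        Filter.Eventually.of_forall fun l => ?_
      by_cases h1 : l ∈ s <;> by_cases h2 : l ∈ t <;> simp [h1, h2]
    | add _ h1 h2 =>
      rename_i G₁ G₂ _
      obtain ⟨T₁, hT₁⟩ := exists_represents_simpleFunc (E := E) G₁
      obtain ⟨T₂, hT₂⟩ := exists_represents_simpleFunc (E := E) G₂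
      have e2 : T = T₁ + T₂ :=
        hu hG (hT₁.add hT₂ (integrable_simpleFunc _) (integrable_simpleFunc _))
      have h3 := (h1 hT₁).add (h2 hT₂)
        (integrable_simpleFunc (_ * G₁)) (integrable_simpleFunc (_ * G₂))
      rw [e2, mul_add]
      refine h3.congr fun f => Filter.Eventually.of_forall fun l => ?_
      simp [mul_add]
  | add _ h1 h2 =>
    rename_i F₁ F₂ _
    obtain ⟨T₁, hT₁⟩ := exists_represents_simpleFunc (E := E) F₁
    obtain ⟨T₂, hT₂⟩ := exists_represents_simpleFunc (E := E) F₂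
    have e2 : S = T₁ + T₂ :=
      hu hF (hT₁.add hT₂ (integrable_simpleFunc _) (integrable_simpleFunc _))
    have h3 := (h1 hT₁).add (h2 hT₂)
      (integrable_simpleFunc (F₁ * G)) (integrable_simpleFunc (F₂ * G))
    rw [e2, add_mul]
    refine h3.congr fun f => Filter.Eventually.of_forall fun l => ?_
    simp [add_mul]

theorem tendsto_two_div : Filter.Tendsto (fun n : ℕ => 2 / ((n : ℝ) + 1)) Filter.atTop (nhds 0) := by
  simpa [div_eq_mul_inv] using (tendsto_one_div_add_atTop_nhds_zero_nat (𝕜 := ℝ)).const_mul 2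

/-- Representing operators pass to uniform limits of the symbols. -/
theorem Represents.of_tendsto {F : ℝ → ℂ} {G : ℕ → ℝ → ℂ} {T : H →L[ℂ] H} {S : ℕ → H →L[ℂ] H}
    {e : ℕ → ℝ} (he : Filter.Tendsto e Filter.atTop (nhds 0))
    (hS : ∀ n, E.Represents (G n) (S n)) (hF : Measurable F) (hG : ∀ n, Measurable (G n))
    {B : ℝ} (hB : ∀ l, ‖F l‖ ≤ B) (hFG : ∀ n l, ‖F l - G n l‖ ≤ e n)
    (hST : Filter.Tendsto S Filter.atTop (nhds T)) : E.Represents F T := by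
  intro f
  have h1 : Filter.Tendsto (fun n => inner ℂ f (S n f)) Filter.atTop (nhds (inner ℂ f (T f))) :=
    tendsto_const_nhds.inner
      (((ContinuousLinearMap.apply ℂ H f).continuous.tendsto T).comp hST)
  refine tendsto_nhds_unique h1 ?_
  simp only [fun n => hS n f]
  have hFi : Integrable F (E.scalarMeasure f) :=
    integrable_of_bounded hF (Filter.Eventually.of_forall hB)
  have hGi : ∀ n, Integrable (G n) (E.scalarMeasure f) := fun n =>
    integrable_of_bounded (hG n) (B := e n + B) (Filter.Eventually.of_forall fun l => by
      have := norm_sub_le (F l) (F l - G n l)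
      rw [sub_sub_cancel] at this
      linarith [hB l, hFG n l])
  rw [tendsto_iff_norm_sub_tendsto_zero]
  refine squeeze_zero (fun _ => norm_nonneg _) (g := fun n => e n * ‖f‖ ^ 2) (fun n => ?_) (by
    simpa using he.mul_const (‖f‖ ^ 2))
  rw [← integral_sub (hGi n) hFi, ← E.scalarMeasure_real_univ]
  exact norm_integral_le_of_norm_le_const (Filter.Eventually.of_forall fun l => by
    rw [norm_sub_rev]; exact hFG n l)

theorem Represents.norm_sub_le_of_simpleFunc {F : ℝ → ℂ} {G : SimpleFunc ℝ ℂ} {S T : H →L[ℂ] H}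
    (hF : E.Represents F T) (hG : E.Represents G S) (hFm : Measurable F)
    {B e : ℝ} (hB : ∀ l, ‖F l‖ ≤ B) (hFG : ∀ l, ‖F l - G l‖ ≤ e) : ‖T - S‖ ≤ 2 * e :=
  (hF.sub hG (fun _ => integrable_of_bounded hFm (Filter.Eventually.of_forall hB))
    (integrable_simpleFunc G)).norm_le ((norm_nonneg _).trans (hFG 0))
      (fun _ => Filter.Eventually.of_forall hFG)

/-- Every bounded Borel function has a spectral integral. -/
theorem exists_represents {F : ℝ → ℂ} (hF : Measurable F) {B : ℝ} (hB : ∀ l, ‖F l‖ ≤ B) :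
    ∃ T, E.Represents F T := by
  obtain ⟨G, hG⟩ := exists_simpleFunc_uniform_approx hF hB
  choose S hS using fun n => exists_represents_simpleFunc (E := E) (G n)
  have hcau : CauchySeq S := by
    refine cauchySeq_of_le_tendsto_0' (fun n : ℕ => 2 * (2 / ((n : ℝ) + 1) + 2 / ((n : ℝ) + 1)))
      (fun n p hnp => ?_) (by simpa using (tendsto_two_div.add tendsto_two_div).const_mul 2)
    rw [dist_eq_norm]
    refine ((hS n).sub (hS p) (integrable_simpleFunc _) (integrable_simpleFunc _)).norm_le
      (by positivity) (fun f => Filter.Eventually.of_forall fun l => ?_)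
    have h1 := norm_sub_le (F l - G p l) (F l - G n l)
    rw [sub_sub_sub_cancel_left] at h1
    have h2 : 2 / ((p : ℝ) + 1) ≤ 2 / ((n : ℝ) + 1) := by gcongr
    linarith [hG n l, hG p l]
  obtain ⟨T, hT⟩ := cauchySeq_tendsto_of_complete hcau
  exact ⟨T, Represents.of_tendsto tendsto_two_div hS hF (fun n => (G n).measurable) hB hG hT⟩

/-- The spectral integral is multiplicative on bounded Borel functions. -/
theorem Represents.mul_of_bounded {F G : ℝ → ℂ} {S T : H →L[ℂ] H} (hF : E.Represents F S)
    (hG : E.Represents G T) (hFm : Measurable F) (hGm : Measurable G) {B D : ℝ}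
    (hB : ∀ l, ‖F l‖ ≤ B) (hD : ∀ l, ‖G l‖ ≤ D) :
    E.Represents (fun l => F l * G l) (S * T) := by
  obtain ⟨P, hP⟩ := exists_simpleFunc_uniform_approx hFm hB
  obtain ⟨Q, hQ⟩ := exists_simpleFunc_uniform_approx hGm hD
  choose U hU using fun n => exists_represents_simpleFunc (E := E) (P n)
  choose V hV using fun n => exists_represents_simpleFunc (E := E) (Q n)
  have hz : Filter.Tendsto (fun n : ℕ => 2 * (2 / ((n : ℝ) + 1))) Filter.atTop (nhds 0) := by
    simpa using tendsto_two_div.const_mul 2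
  have hUS : Filter.Tendsto U Filter.atTop (nhds S) := by
    rw [tendsto_iff_norm_sub_tendsto_zero]
    refine squeeze_zero (fun _ => norm_nonneg _) (fun n => ?_) hz
    rw [norm_sub_rev]
    exact hF.norm_sub_le_of_simpleFunc (hU n) hFm hB (hP n)
  have hVT : Filter.Tendsto V Filter.atTop (nhds T) := by
    rw [tendsto_iff_norm_sub_tendsto_zero]
    refine squeeze_zero (fun _ => norm_nonneg _) (fun n => ?_) hz
    rw [norm_sub_rev]
    exact hG.norm_sub_le_of_simpleFunc (hV n) hGm hD (hQ n)
  have hB0 : 0 ≤ B := (norm_nonneg _).trans (hB 0)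
  refine Represents.of_tendsto (G := fun n l => P n l * Q n l)
    (e := fun n : ℕ => B * (2 / ((n : ℝ) + 1)) + 2 / ((n : ℝ) + 1) * (D + 2))
    (B := B * D)
    (by simpa using (tendsto_two_div.const_mul B).add (tendsto_two_div.mul_const (D + 2)))
    (fun n => (hU n).mul_simpleFunc (hV n)) (hFm.mul hGm)
    (fun n => (P n).measurable.mul (Q n).measurable) (fun l => ?_) (fun n l => ?_)
    (hUS.mul hVT)
  · rw [norm_mul]
    exact mul_le_mul (hB l) (hD l) (norm_nonneg _) hB0
  · have e1 : F l * G l - P n l * Q n l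
        = F l * (G l - Q n l) + (F l - P n l) * (G l - (G l - Q n l)) := by ring
    have h2 : 2 / ((n : ℝ) + 1) ≤ 2 := by
      rw [div_le_iff₀ (by positivity)]; nlinarith [Nat.cast_nonneg (α := ℝ) n]
    rw [e1]
    refine (norm_add_le _ _).trans ?_
    rw [norm_mul, norm_mul]
    exact add_le_add (mul_le_mul (hB l) (hQ n l) (norm_nonneg _) hB0)
      (mul_le_mul (hP n l) ((norm_sub_le _ _).trans (add_le_add (hD l) ((hQ n l).trans h2)))
        (norm_nonneg _) (by positivity))

/-! ### Spectral measures carried by the half-line -/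

theorem ae_nonneg_scalarMeasure (hE : E.proj (Iio 0) = 0) (f : H) :
    ∀ᵐ l ∂(E.scalarMeasure f), 0 ≤ l := by
  have : E.scalarMeasure f (Iio 0) = 0 := by
    rw [E.scalarMeasure_apply measurableSet_Iio, hE]; simp
  rw [ae_iff]
  convert this using 2
  ext l; simp

theorem ae_eq_indicator_Ici (hE : E.proj (Iio 0) = 0) (F : ℝ → ℂ) (f : H) :
    F =ᵐ[E.scalarMeasure f] (Ici 0).indicator F := by
  filter_upwards [ae_nonneg_scalarMeasure hE f] with l hl
  rw [indicator_of_mem (mem_Ici.2 hl)]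

theorem norm_indicator_Ici_le {F : ℝ → ℂ} {B : ℝ} (hB : ∀ l, 0 ≤ l → ‖F l‖ ≤ B) (l : ℝ) :
    ‖(Ici 0).indicator F l‖ ≤ B := by
  by_cases h : 0 ≤ l
  · rw [indicator_of_mem (mem_Ici.2 h)]; exact hB l h
  · rw [indicator_of_notMem (by simpa using h), norm_zero]
    exact (norm_nonneg _).trans (hB 0 le_rfl)

theorem represents_integral (hE : E.proj (Iio 0) = 0) {F : ℝ → ℂ} (hF : Measurable F) {B : ℝ}
    (hB : ∀ l, 0 ≤ l → ‖F l‖ ≤ B) : E.Represents F (E.integral F) := by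
  obtain ⟨T, hT⟩ := exists_represents (E := E) (hF.indicator measurableSet_Ici)
    (norm_indicator_Ici_le hB)
  have hT' : E.Represents F T := hT.congr fun f => (ae_eq_indicator_Ici hE F f).symm
  rwa [hT'.integral_eq]

theorem Represents.mul (hE : E.proj (Iio 0) = 0) {F G : ℝ → ℂ} {S T : H →L[ℂ] H}
    (hF : E.Represents F S) (hG : E.Represents G T) (hFm : Measurable F) (hGm : Measurable G)
    {B D : ℝ} (hB : ∀ l, 0 ≤ l → ‖F l‖ ≤ B) (hD : ∀ l, 0 ≤ l → ‖G l‖ ≤ D) :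
    E.Represents (fun l => F l * G l) (S * T) := by
  refine ((hF.congr (ae_eq_indicator_Ici hE F)).mul_of_bounded (hG.congr (ae_eq_indicator_Ici hE G))
    (hFm.indicator measurableSet_Ici) (hGm.indicator measurableSet_Ici) (norm_indicator_Ici_le hB)
    (norm_indicator_Ici_le hD)).congr fun f => ?_
  filter_upwards [ae_eq_indicator_Ici hE F f, ae_eq_indicator_Ici hE G f] with l h1 h2
  rw [← h1, ← h2]

theorem Represents.norm_le_of_nonneg (hE : E.proj (Iio 0) = 0) {F : ℝ → ℂ} {T : H →L[ℂ] H}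
    (h : E.Represents F T) {B : ℝ} (hB : ∀ l, 0 ≤ l → ‖F l‖ ≤ B) : ‖T‖ ≤ 2 * B :=
  h.norm_le ((norm_nonneg _).trans (hB 0 le_rfl)) fun f => by
    filter_upwards [ae_nonneg_scalarMeasure hE f] with l hl using hB l hl

/-- Spectral integrals of superpositions: if `F = ∫ w(ξ) Φ(ξ, ·) dξ` on the spectrum, then
`⟨g, F(L) f⟩ = ∫ w(ξ) ⟨g, Φ(ξ, L) f⟩ dξ`. -/
theorem Represents.inner_eq_integral (hE : E.proj (Iio 0) = 0) {F : ℝ → ℂ} {T : H →L[ℂ] H}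
    (hT : E.Represents F T) {w : ℝ → ℂ} (hw : Integrable w) {Φ : ℝ → ℝ → ℂ}
    (hΦ : Measurable (Function.uncurry Φ)) {B : ℝ} (hB : ∀ ξ l, 0 ≤ l → ‖Φ ξ l‖ ≤ B)
    {S : ℝ → H →L[ℂ] H} (hS : ∀ ξ, E.Represents (Φ ξ) (S ξ))
    (hF : ∀ l, 0 ≤ l → F l = ∫ ξ, w ξ * Φ ξ l) (g f : H) :
    Integrable (fun ξ => w ξ * inner ℂ g (S ξ f)) ∧
      inner ℂ g (T f) = ∫ ξ, w ξ * inner ℂ g (S ξ f) := by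
  have hint : ∀ h : H, Integrable (Function.uncurry fun ξ l => w ξ * Φ ξ l)
      ((volume : Measure ℝ).prod (E.scalarMeasure h)) := by
    intro h
    have h1 : Integrable (fun p : ℝ × ℝ => w p.1)
        ((volume : Measure ℝ).prod (E.scalarMeasure h)) := hw.comp_fst _
    refine (h1.norm.const_mul B).mono'
      (h1.aestronglyMeasurable.mul hΦ.aestronglyMeasurable) ?_
    have h2 : ∀ᵐ p ∂((volume : Measure ℝ).prod (E.scalarMeasure h)), 0 ≤ p.2 :=
      (Measure.quasiMeasurePreserving_snd).ae (ae_nonneg_scalarMeasure hE h)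
    filter_upwards [h2] with p hp
    simp only [Function.uncurry, norm_mul]
    rw [mul_comm]
    exact mul_le_mul_of_nonneg_right (hB _ _ hp) (norm_nonneg _)
  have hdiag : ∀ h : H, Integrable (fun ξ => w ξ * inner ℂ h (S ξ h)) ∧
      inner ℂ h (T h) = ∫ ξ, w ξ * inner ℂ h (S ξ h) := by
    intro h
    have e : (fun ξ => w ξ * inner ℂ h (S ξ h))
        = fun ξ => ∫ l, w ξ * Φ ξ l ∂(E.scalarMeasure h) := by
      funext ξ
      rw [integral_const_mul, hS ξ h]
    rw [e]
    refine ⟨(hint h).integral_prod_left, ?_⟩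
    rw [integral_integral_swap (hint h), hT h]
    refine integral_congr_ae ?_
    filter_upwards [ae_nonneg_scalarMeasure hE h] with l hl using hF l hl
  have e : (fun ξ => w ξ * inner ℂ g (S ξ f)) = fun ξ =>
      (w ξ * inner ℂ (g + f) (S ξ (g + f)) - w ξ * inner ℂ (g - f) (S ξ (g - f))
        - Complex.I * (w ξ * inner ℂ (g + Complex.I • f) (S ξ (g + Complex.I • f)))
        + Complex.I * (w ξ * inner ℂ (g - Complex.I • f) (S ξ (g - Complex.I • f)))) / 4 := by
    funext ξ
    rw [inner_map_polarization_right]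
    ring
  obtain ⟨i1, j1⟩ := hdiag (g + f)
  obtain ⟨i2, j2⟩ := hdiag (g - f)
  obtain ⟨i3, j3⟩ := hdiag (g + Complex.I • f)
  obtain ⟨i4, j4⟩ := hdiag (g - Complex.I • f)
  rw [e]
  have k3 := i3.const_mul Complex.I
  have k4 := i4.const_mul Complex.I
  have k12 := i1.sub i2
  have k123 := k12.sub k3
  refine ⟨(k123.add k4).div_const 4, ?_⟩
  have e1 := integral_add k123 k4
  have e2 := integral_sub k12 k3
  have e3 := integral_sub i1 i2
  simp only [Pi.sub_apply] at e1 e2 e3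
  rw [integral_div, e1, e2, e3, integral_const_mul, integral_const_mul, ← j1, ← j2, ← j3, ← j4]
  exact inner_map_polarization_right T g f

/-- The scalar measure of `E(S) f` is carried by `S`. -/
theorem ae_mem_scalarMeasure_proj {S : Set ℝ} (hS : MeasurableSet S) (f : H) :
    ∀ᵐ l ∂(E.scalarMeasure (E.proj S f)), l ∈ S := by
  have h0 : E.proj ∅ = 0 := by
    ext f
    have h := (E.hasSum_proj (fun _ => ∅) (fun _ => MeasurableSet.empty)
      (fun _ _ _ => disjoint_bot_left) f).summable
    rwa [summable_const_iff] at h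
  have h1 : E.proj Sᶜ (E.proj S f) = 0 := by
    have := E.proj_inter Sᶜ S hS.compl hS
    rw [compl_inter_self, h0] at this
    exact (congrArg (fun T : H →L[ℂ] H => T f) this).symm
  have h2 : E.scalarMeasure (E.proj S f) Sᶜ = 0 := by
    rw [E.scalarMeasure_apply hS.compl, h1]; simp
  exact h2

/-- The resolution of a non-negative operator is carried by `[0, ∞)`. -/
theorem IsResolutionOf.proj_Iio_zero {L : H →ₗ.[ℂ] H} (hL : E.IsResolutionOf L)
    (hn : IsNonnegOperator L) : E.proj (Iio 0) = 0 := by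
  -- the truncations to `[-(j+1), -1/(j+1)]` lie in the domain of `L`
  let S : ℕ → Set ℝ := fun j => Icc (-((j : ℝ) + 1)) (-(1 / ((j : ℝ) + 1)))
  have hSm : ∀ j, MeasurableSet (S j) := fun j => measurableSet_Icc
  have hzero : ∀ j f, E.proj (S j) f = 0 := by
    intro j f
    have hj : (0 : ℝ) < (j : ℝ) + 1 := by positivity
    have hae := ae_mem_scalarMeasure_proj (E := E) (hSm j) f
    have hdom : E.proj (S j) f ∈ L.domain := by
      rw [hL.mem_domain_iff]
      calc ∫⁻ l, ENNReal.ofReal (l ^ 2) ∂(E.scalarMeasure (E.proj (S j) f))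
          ≤ ∫⁻ _, ENNReal.ofReal (((j : ℝ) + 1) ^ 2) ∂(E.scalarMeasure (E.proj (S j) f)) := by
            refine lintegral_mono_ae ?_
            filter_upwards [hae] with l hl
            refine ENNReal.ofReal_le_ofReal ?_
            have h1 := hl.1
            have h2 := hl.2
            have h3 : 0 < 1 / ((j : ℝ) + 1) := by positivity
            nlinarith
        _ < ∞ := by
            rw [lintegral_const]
            exact ENNReal.mul_lt_top ENNReal.ofReal_lt_top (measure_lt_top _ _)
    have h1 := hn ⟨_, hdom⟩
    rw [← inner_conj_symm, Complex.conj_re, hL.inner_apply ⟨_, hdom⟩, Complex.ofReal_re] at h1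
    have h2 : ∫ l, l ∂(E.scalarMeasure (E.proj (S j) f))
        ≤ ∫ _, -(1 / ((j : ℝ) + 1)) ∂(E.scalarMeasure (E.proj (S j) f)) := by
      refine integral_mono_ae ?_ (integrable_const _) ?_
      · refine Integrable.of_bound measurable_id.aestronglyMeasurable ((j : ℝ) + 1) ?_
        filter_upwards [hae] with l hl
        rw [Real.norm_eq_abs, abs_le]
        have h3 : 0 < 1 / ((j : ℝ) + 1) := by positivity
        exact ⟨hl.1, by linarith [hl.2]⟩
      · filter_upwards [hae] with l hl using hl.2
    rw [integral_const, E.scalarMeasure_real_univ, smul_eq_mul] at h2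
    have h3 : 0 < 1 / ((j : ℝ) + 1) := by positivity
    have h4 : ‖E.proj (S j) f‖ ^ 2 ≤ 0 := by
      by_contra hcon
      push Not at hcon
      nlinarith [mul_pos hcon h3]
    exact norm_eq_zero.1 (pow_eq_zero_iff two_ne_zero |>.1 (le_antisymm h4 (sq_nonneg _)))
  ext f
  have hU : Iio (0 : ℝ) = ⋃ j, S j := by
    ext l
    simp only [mem_Iio, mem_iUnion, S, mem_Icc]
    constructor
    · intro hl
      obtain ⟨j, hj⟩ := exists_nat_gt (max (-l) (1 / -l))
      have h1 := (le_max_left _ _).trans_lt hj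
      have h2 := (le_max_right _ _).trans_lt hj
      refine ⟨j, by linarith, ?_⟩
      rw [div_lt_iff₀ (by linarith)] at h2
      rw [le_neg, div_le_iff₀ (by positivity)]
      nlinarith
    · rintro ⟨j, -, h2⟩
      have h3 : 0 < 1 / ((j : ℝ) + 1) := by positivity
      linarith
  have h1 : E.scalarMeasure f (Iio 0) = 0 := by
    rw [hU, measure_iUnion_null_iff]
    intro j
    rw [E.scalarMeasure_apply (hSm j), hzero]; simp
  rw [E.scalarMeasure_apply measurableSet_Iio, ENNReal.ofReal_eq_zero] at h1
  exact norm_eq_zero.1 (pow_eq_zero_iff two_ne_zero |>.1 (le_antisymm h1 (sq_nonneg _)))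

end ProjectionValuedMeasure

theorem spectralResolution_proj_Iio_zero {L : H →ₗ.[ℂ] H} (hn : IsNonnegOperator L) :
    (spectralResolution L).proj (Iio 0) = 0 := by
  unfold spectralResolution
  split_ifs with h
  · exact h.choose_spec.proj_Iio_zero hn
  · simp [default, Inhabited.default]

end FunctionalCalculus

/-! ### From real to complex times by the Phragmén–Lindelöf principle -/

section PhragmenLindelofDecay

theorem mul_sin_le_sin_mul {α ψ : ℝ} (hα0 : 0 ≤ α) (hα1 : α ≤ 1) (h0 : 0 ≤ ψ) (h1 : ψ ≤ Real.pi) :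
    α * Real.sin ψ ≤ Real.sin (α * ψ) := by
  have h := strictConcaveOn_sin_Icc.concaveOn.2 (x := ψ) (y := 0) ⟨h0, h1⟩
    ⟨le_rfl, Real.pi_pos.le⟩ hα0 (sub_nonneg.2 hα1) (by ring)
  simpa using h

/-- The function `Re (i (-i w)^α)`, harmonic in the right half-plane and zero on the
positive imaginary half-axis, is bounded below by `α |w|^{α-1} Re w`. -/
theorem le_re_I_mul_cpow {α : ℝ} (hα0 : 0 < α) (hα1 : α ≤ 1) {w : ℂ} (hr : 0 < w.re) :
    α * (‖w‖ ^ (α - 1) * w.re) ≤ (Complex.I * (-Complex.I * w) ^ (α : ℂ)).re := by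
  have hw : w ≠ 0 := fun h => by simp [h] at hr
  have hw' : 0 < ‖w‖ := norm_pos_iff.2 hw
  rw [Complex.I_mul_re, Complex.cpow_ofReal_im]
  have hnorm : ‖-Complex.I * w‖ = ‖w‖ := by simp
  have hsin : Real.sin (-Complex.arg (-Complex.I * w)) = w.re / ‖w‖ := by
    rw [Real.sin_neg, Complex.sin_arg, hnorm]
    simp [neg_div]
  have harg0 : 0 ≤ -Complex.arg (-Complex.I * w) := by
    rw [neg_nonneg, ← not_lt]
    intro h
    have := Complex.arg_nonneg_iff.1 h.le
    simp at this
    linarith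
  have harg1 : -Complex.arg (-Complex.I * w) ≤ Real.pi := by
    linarith [Complex.neg_pi_lt_arg (-Complex.I * w)]
  have h := mul_sin_le_sin_mul hα0.le hα1 harg0 harg1
  rw [hsin] at h
  rw [hnorm, ← mul_neg, ← Real.sin_neg, ← neg_mul, mul_comm _ α]
  refine le_trans (le_of_eq ?_) (mul_le_mul_of_nonneg_left h (Real.rpow_nonneg hw'.le α))
  rw [Real.rpow_sub_one hw'.ne']
  ring

/-- A bounded analytic function on the right half-plane that decays like `exp(-κ t^{-α})` as
`t → 0` along the positive axis decays correspondingly at complex points; this is the case of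
points in the fourth quadrant. -/
theorem norm_le_exp_of_im_nonpos {h : ℂ → ℂ} {κ α C : ℝ} (hα0 : 0 < α) (hα1 : α ≤ 1) (hκ : 0 ≤ κ)
    (hd : ∀ z : ℂ, 0 < z.re → DifferentiableAt ℂ h z) (hb : ∀ z : ℂ, 0 < z.re → ‖h z‖ ≤ C)
    (hr : ∀ t : ℝ, 0 < t → ‖h t‖ ≤ C * Real.exp (-(κ * t ^ (-α)))) {z : ℂ} (hz : 0 < z.re)
    (hzi : z.im ≤ 0) :
    ‖h z‖ ≤ C * Real.exp (-(κ * (α / 2) * (z.re / ‖z‖ ^ (1 + α)))) := by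
  have hC : 0 ≤ C := (norm_nonneg _).trans (hb z hz)
  have hz0 : z ≠ 0 := fun h => by simp [h] at hz
  have hzn : 0 < ‖z‖ := norm_pos_iff.2 hz0
  have hw0re : (z⁻¹).re = z.re / ‖z‖ ^ 2 := by rw [Complex.inv_re, Complex.normSq_eq_norm_sq]
  have hw0im : 0 ≤ (z⁻¹).im := by
    rw [Complex.inv_im]
    exact div_nonneg (neg_nonneg.2 hzi) (Complex.normSq_nonneg _)
  have hw0pos : 0 < (z⁻¹).re := by rw [hw0re]; positivity
  -- half of the real part of `1/z` is spent on keeping away from the imaginary axis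
  set δ : ℝ := (z⁻¹).re / 2 with hδdef
  have hδ : 0 < δ := by positivity
  set G : ℂ → ℂ := fun w =>
    h ((w + δ)⁻¹) * Complex.exp (κ * (Complex.I * (-Complex.I * w) ^ (α : ℂ))) with hG
  have hinv : ∀ w : ℂ, 0 ≤ w.re → 0 < ((w + δ)⁻¹).re := by
    intro w hw
    rw [Complex.inv_re]
    have h1 : 0 < (w + δ).re := by simp; linarith
    exact div_pos h1 (Complex.normSq_pos.2 fun h => by simp [h] at h1)
  have hne : ∀ w : ℂ, 0 ≤ w.re → w + δ ≠ 0 := by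
    intro w hw h0
    have := congrArg Complex.re h0
    simp at this
    linarith
  have hhd : ∀ w : ℂ, 0 ≤ w.re → DifferentiableAt ℂ (fun w : ℂ => h ((w + δ)⁻¹)) w := by
    intro w hw
    exact (hd _ (hinv w hw)).comp w (((differentiableAt_id).add_const _).inv (hne w hw))
  have hnG : ∀ w : ℂ, ‖G w‖ = ‖h ((w + δ)⁻¹)‖ *
      Real.exp (κ * (Complex.I * (-Complex.I * w) ^ (α : ℂ)).re) := by
    intro w
    simp only [hG]
    rw [norm_mul, Complex.norm_exp, Complex.re_ofReal_mul]
  have hre_le : ∀ w : ℂ, (Complex.I * (-Complex.I * w) ^ (α : ℂ)).re ≤ ‖w‖ ^ α := by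
    intro w
    refine (Complex.re_le_norm _).trans ?_
    rw [norm_mul, Complex.norm_I, one_mul, Complex.norm_cpow_real]
    simp
  have hmain : ‖G (z⁻¹ - δ)‖ ≤ C := by
    refine PhragmenLindelof.quadrant_I (C := C) (f := G) ⟨?_, ?_⟩ ?_ ?_ ?_ ?_ ?_
    · intro w hw
      have hw1 : 0 < w.re := hw.1
      have hw2 : 0 < w.im := hw.2
      refine DifferentiableAt.differentiableWithinAt ?_
      refine (hhd w hw1.le).mul (DifferentiableAt.cexp ?_)
      refine DifferentiableAt.const_mul (DifferentiableAt.const_mul ?_ _) _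
      refine DifferentiableAt.cpow_const (differentiableAt_id.const_mul _) ?_
      left
      simpa using hw2
    · rw [Complex.closure_reProdIm, closure_Ioi]
      intro w hw
      have hw1 : 0 ≤ w.re := hw.1
      have hw2 : 0 ≤ w.im := hw.2
      refine ContinuousAt.continuousWithinAt ?_
      refine (hhd w hw1).continuousAt.mul (ContinuousAt.cexp ?_)
      refine continuousAt_const.mul (continuousAt_const.mul ?_)
      refine ContinuousAt.comp (f := fun w : ℂ => -Complex.I * w)
        (g := fun u : ℂ => u ^ (α : ℂ)) ?_ (by fun_prop)
      refine Complex.continuousAt_cpow_const_of_re_pos (Or.inl ?_) (by simpa using hα0)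
      simpa using hw2
    · refine ⟨1, by norm_num, κ, Asymptotics.IsBigO.of_bound C ?_⟩
      have h1 : ∀ᶠ w in Bornology.cobounded ℂ, 1 ≤ ‖w‖ :=
        tendsto_norm_cobounded_atTop.eventually_ge_atTop 1
      have h2 : ∀ᶠ w in Filter.principal (Ioi (0 : ℝ) ×ℂ Ioi (0 : ℝ)), 0 ≤ w.re :=
        Filter.eventually_principal.2 fun w hw => le_of_lt hw.1
      filter_upwards [h1.filter_mono inf_le_left, h2.filter_mono inf_le_right] with w hw1 hw2
      rw [hnG, Real.norm_eq_abs, Real.abs_exp]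
      refine mul_le_mul (hb _ (hinv w hw2)) (Real.exp_le_exp.2 ?_) (Real.exp_pos _).le hC
      refine mul_le_mul_of_nonneg_left ((hre_le w).trans ?_) hκ
      exact Real.rpow_le_rpow_of_exponent_le hw1 hα1
    · intro x hx
      have hxδ : 0 < x + δ := by positivity
      have h1 := hr ((x + δ)⁻¹) (by positivity)
      rw [Real.inv_rpow hxδ.le, Real.rpow_neg hxδ.le, inv_inv] at h1
      push_cast at h1
      rw [hnG]
      refine (mul_le_mul_of_nonneg_right h1 (Real.exp_pos _).le).trans ?_
      rw [mul_assoc, ← Real.exp_add]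
      refine mul_le_of_le_one_right hC (Real.exp_le_one_iff.2 ?_)
      have h2 : (Complex.I * (-Complex.I * (x : ℂ)) ^ (α : ℂ)).re ≤ (x + δ) ^ α := by
        refine (hre_le x).trans ?_
        rw [Complex.norm_real, Real.norm_eq_abs, abs_of_nonneg hx]
        exact Real.rpow_le_rpow hx (by linarith) hα0.le
      nlinarith [mul_le_mul_of_nonneg_left h2 hκ]
    · intro y hy
      rw [hnG]
      have h1 : -Complex.I * (y * Complex.I) = (y : ℂ) := by
        ring_nf; simp
      rw [h1, ← Complex.ofReal_cpow hy]
      simp only [Complex.I_mul_re, Complex.ofReal_im, neg_zero, mul_zero, Real.exp_zero, mul_one]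
      exact hb _ (hinv _ (by simp))
    · simp only [Complex.sub_re, Complex.ofReal_re]; linarith
    · simpa using hw0im
  rw [hnG, sub_add_cancel, inv_inv] at hmain
  have hre' : (z⁻¹ - (δ : ℂ)).re = δ := by
    rw [Complex.sub_re, Complex.ofReal_re, hδdef]; ring
  have him' : (z⁻¹ - (δ : ℂ)).im = (z⁻¹).im := by simp
  have hlow := le_re_I_mul_cpow hα0 hα1 (w := z⁻¹ - δ) (by rw [hre']; exact hδ)
  rw [hre'] at hlow
  have hwn : ‖z⁻¹ - (δ : ℂ)‖ ≤ ‖z‖⁻¹ := by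
    rw [← norm_inv, ← sq_le_sq₀ (norm_nonneg _) (norm_nonneg _), ← Complex.normSq_eq_norm_sq,
      ← Complex.normSq_eq_norm_sq, Complex.normSq_apply, Complex.normSq_apply, hre', him']
    have : (z⁻¹).re = 2 * δ := by rw [hδdef]; ring
    nlinarith
  have hwpos : 0 < ‖z⁻¹ - (δ : ℂ)‖ := norm_pos_iff.2 fun h0 => by
    rw [h0] at hre'; simp at hre'; linarith
  have hpow : (‖z‖⁻¹) ^ (α - 1) ≤ ‖z⁻¹ - (δ : ℂ)‖ ^ (α - 1) :=
    Real.rpow_le_rpow_of_nonpos hwpos hwn (by linarith)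
  have hid : (‖z‖⁻¹) ^ (α - 1) * δ = z.re / ‖z‖ ^ (1 + α) / 2 := by
    rw [hδdef, hw0re, Real.inv_rpow hzn.le, Real.rpow_sub_one hzn.ne', Real.rpow_one_add' hzn.le
      (by positivity)]
    have : 0 < ‖z‖ ^ α := Real.rpow_pos_of_pos hzn α
    field_simp
  have hfin : κ * (α / 2) * (z.re / ‖z‖ ^ (1 + α))
      ≤ κ * (Complex.I * (-Complex.I * (z⁻¹ - δ)) ^ (α : ℂ)).re := by
    rw [mul_assoc]
    refine mul_le_mul_of_nonneg_left (le_trans (le_of_eq ?_)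
      ((mul_le_mul_of_nonneg_left (mul_le_mul_of_nonneg_right hpow hδ.le) hα0.le).trans hlow)) hκ
    rw [hid]; ring
  have h3 := (mul_le_mul_of_nonneg_left (Real.exp_le_exp.2 hfin) (norm_nonneg _)).trans hmain
  rw [Real.exp_neg, ← div_eq_mul_inv, le_div_iff₀ (Real.exp_pos _)]
  exact h3

/-- A bounded analytic function on the right half-plane that decays like `exp(-κ t^{-α})` as
`t → 0` along the positive axis decays like `exp(-c κ Re z / |z|^{1+α})` at complex points. -/
theorem norm_le_exp_of_re_pos {h : ℂ → ℂ} {κ α C : ℝ} (hα0 : 0 < α) (hα1 : α ≤ 1) (hκ : 0 ≤ κ)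
    (hd : ∀ z : ℂ, 0 < z.re → DifferentiableAt ℂ h z) (hb : ∀ z : ℂ, 0 < z.re → ‖h z‖ ≤ C)
    (hr : ∀ t : ℝ, 0 < t → ‖h t‖ ≤ C * Real.exp (-(κ * t ^ (-α)))) {z : ℂ} (hz : 0 < z.re) :
    ‖h z‖ ≤ C * Real.exp (-(κ * (α / 2) * (z.re / ‖z‖ ^ (1 + α)))) := by
  rcases le_total z.im 0 with hi | hi
  · exact norm_le_exp_of_im_nonpos hα0 hα1 hκ hd hb hr hz hi
  · have := norm_le_exp_of_im_nonpos (h := starRingEnd ℂ ∘ h ∘ starRingEnd ℂ) (C := C)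
      hα0 hα1 hκ ?_ ?_ ?_ (z := starRingEnd ℂ z) (by simpa using hz) (by simpa using hi)
    · simpa using this
    · intro z hz
      have := (hd (starRingEnd ℂ z) (by simpa using hz)).conj_conj
      simpa using this
    · intro z hz
      simpa using hb (starRingEnd ℂ z) (by simpa using hz)
    · intro t ht
      simpa using hr t ht

end PhragmenLindelofDecay

/-! ### Restriction operators -/

section RestrictionAlgebra

variable {X : Type*} [MeasurableSpace X] {μ : Measure X}

theorem restrictProj_coeFn {S : Set X} (hS : MeasurableSet S) (f : Lp ℂ 2 μ) :
    (restrictProj μ hS f : X → ℂ) =ᵐ[μ] S.indicator f :=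
  restrictLinear_coeFn μ hS f

theorem norm_restrictProj_le {S : Set X} (hS : MeasurableSet S) : ‖restrictProj μ hS‖ ≤ 1 :=
  LinearMap.mkContinuous_norm_le _ zero_le_one _

theorem restrictProj_mul_restrictProj {S T : Set X} (hS : MeasurableSet S)
    (hT : MeasurableSet T) (hST : S ⊆ T) :
    restrictProj μ hS * restrictProj μ hT = restrictProj μ hS := by
  ext1 f
  apply Lp.ext
  rw [mul_apply_eq_comp]
  filter_upwards [restrictProj_coeFn hS (restrictProj μ hT f), restrictProj_coeFn hT f,
    restrictProj_coeFn hS f] with x h1 h2 h3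
  rw [h1, h3]
  by_cases hx : x ∈ S
  · rw [indicator_of_mem hx, indicator_of_mem hx, h2, indicator_of_mem (hST hx)]
  · rw [indicator_of_notMem hx, indicator_of_notMem hx]

theorem restrictProj_mul_restrictProj' {S T : Set X} (hS : MeasurableSet S)
    (hT : MeasurableSet T) (hST : S ⊆ T) :
    restrictProj μ hT * restrictProj μ hS = restrictProj μ hS := by
  ext1 f
  apply Lp.ext
  rw [mul_apply_eq_comp]
  filter_upwards [restrictProj_coeFn hT (restrictProj μ hS f), restrictProj_coeFn hS f]
    with x h1 h2
  rw [h1, h2]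
  by_cases hx : x ∈ S
  · rw [indicator_of_mem hx, indicator_of_mem (hST hx), h2, indicator_of_mem hx]
  · rw [indicator_of_notMem hx]
    by_cases hx' : x ∈ T
    · rw [indicator_of_mem hx', h2, indicator_of_notMem hx]
    · rw [indicator_of_notMem hx']

theorem restrictProj_eq_zero {S : Set X} (hS : MeasurableSet S) (h : S = ∅) :
    restrictProj μ hS = 0 := by
  ext1 f
  apply Lp.ext
  filter_upwards [restrictProj_coeFn hS f, Lp.coeFn_zero ℂ 2 μ] with x h1 h2
  rw [h1, _root_.zero_apply, h2, h]
  simp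

theorem inner_restrictProj_left {S : Set X} (hS : MeasurableSet S) (f g : Lp ℂ 2 μ) :
    inner ℂ (restrictProj μ hS f) g = inner ℂ f (restrictProj μ hS g) := by
  rw [L2.inner_def, L2.inner_def]
  refine integral_congr_ae ?_
  filter_upwards [restrictProj_coeFn hS f, restrictProj_coeFn hS g] with x h1 h2
  rw [h1, h2]
  by_cases hx : x ∈ S <;> simp [hx]

theorem inner_restrictProj_self {S : Set X} (hS : MeasurableSet S) (f : Lp ℂ 2 μ) :
    inner ℂ f (restrictProj μ hS f) = ((‖restrictProj μ hS f‖ ^ 2 : ℝ) : ℂ) := by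
  have h : restrictProj μ hS (restrictProj μ hS f) = restrictProj μ hS f :=
    congrArg (fun T : Lp ℂ 2 μ →L[ℂ] Lp ℂ 2 μ => T f)
      (restrictProj_mul_restrictProj hS hS Subset.rfl)
  rw [← h, ← inner_restrictProj_left, h, inner_self_eq_norm_sq_to_K]
  push_cast
  rfl

theorem restrictProj_eq_sum {ι : Type*} [Fintype ι] {S : Set X} (hS : MeasurableSet S)
    {Q : ι → Set X} (hQ : ∀ i, MeasurableSet (Q i)) (hd : Pairwise fun i j => Disjoint (Q i) (Q j))
    (hU : S = ⋃ i, Q i) : restrictProj μ hS = ∑ i, restrictProj μ (hQ i) := by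
  classical
  ext1 f
  apply Lp.ext
  rw [_root_.sum_apply]
  have h1 : ∀ᵐ x ∂μ, ∀ i, (restrictProj μ (hQ i) f : X → ℂ) x = (Q i).indicator f x :=
    ae_all_iff.2 fun i => restrictProj_coeFn (hQ i) f
  filter_upwards [restrictProj_coeFn hS f,
    Lp.coeFn_fun_finsetSum Finset.univ (fun i => restrictProj μ (hQ i) f), h1] with x h2 h3 h4
  rw [h2, h3]
  simp only [h4]
  by_cases hx : x ∈ S
  · obtain ⟨i, hi⟩ := mem_iUnion.1 (hU ▸ hx)
    rw [indicator_of_mem hx, Finset.sum_eq_single i, indicator_of_mem hi]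
    · intro j _ hj
      exact indicator_of_notMem (fun h => Set.disjoint_left.1 (hd hj) h hi) _
    · simp
  · rw [indicator_of_notMem hx]
    refine (Finset.sum_eq_zero fun i _ => indicator_of_notMem (fun h => hx ?_) _).symm
    rw [hU]
    exact mem_iUnion.2 ⟨i, h⟩

theorem sum_norm_restrictProj_sq_le {ι : Type*} [Fintype ι] {S : Set X} (hS : MeasurableSet S)
    {Q : ι → Set X} (hQ : ∀ i, MeasurableSet (Q i)) (hd : Pairwise fun i j => Disjoint (Q i) (Q j))
    (hU : S = ⋃ i, Q i) (f : Lp ℂ 2 μ) : ∑ i, ‖restrictProj μ (hQ i) f‖ ^ 2 ≤ ‖f‖ ^ 2 := by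
  have h1 : ((∑ i, ‖restrictProj μ (hQ i) f‖ ^ 2 : ℝ) : ℂ) = ((‖restrictProj μ hS f‖ ^ 2 : ℝ) : ℂ) := by
    rw [← inner_restrictProj_self, restrictProj_eq_sum hS hQ hd hU, _root_.sum_apply, inner_sum,
      Complex.ofReal_sum]
    exact Finset.sum_congr rfl fun i _ => (inner_restrictProj_self (hQ i) f).symm
  rw [Complex.ofReal_inj] at h1
  rw [h1]
  have h2 := (restrictProj μ hS).le_of_opNorm_le (norm_restrictProj_le hS) f
  rw [one_mul] at h2
  gcongr

end RestrictionAlgebra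

/-! ### Separated sets in spaces of homogeneous type -/

section Separated

variable {X : Type*} [MetricSpace X] [MeasurableSpace X] [BorelSpace X] {μ : Measure X} {n A : ℝ}

/-- The balls of radius `ρ/2` around the points are disjoint and have volume comparable to that of
the ball containing them. -/
theorem IsHomogeneousType.card_separated_le (h : IsHomogeneousType μ n A) (hA : 0 ≤ A) {ρ : ℝ}
    (hρ : 0 < ρ) {S : Finset X} (hS : ∀ x ∈ S, ∀ y ∈ S, x ≠ y → ρ ≤ dist x y) {x : X} {l : ℝ}
    (hl : 0 ≤ l) (hx : ∀ y ∈ S, dist x y < l * ρ) : (S.card : ℝ) ≤ A * (4 * l + 2) ^ n := by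
  set V := μ (Metric.ball x ((l + 1) * ρ)) with hV
  set c := ENNReal.ofReal (A * (4 * l + 2) ^ n) with hc
  have hV0 : V ≠ 0 := (h.ball_pos x _ (by positivity)).ne'
  have hVt : V ≠ ∞ := (h.ball_lt_top x _ (by positivity)).ne
  have h1 : ∀ y ∈ S, V ≤ c * μ (Metric.ball y (ρ / 2)) := by
    intro y hy
    refine (measure_mono ?_).trans (h.ball_le y (ρ / 2) (by positivity) (4 * l + 2) (by linarith))
    refine Metric.ball_subset_ball' ?_
    have := (hx y hy).le
    nlinarith
  have h2 : ∑ y ∈ S, μ (Metric.ball y (ρ / 2)) ≤ V := by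
    rw [← measure_biUnion_finset]
    · refine measure_mono (iUnion₂_subset fun y hy => Metric.ball_subset_ball' ?_)
      have := (hx y hy).le
      rw [dist_comm] at this
      nlinarith
    · intro y hy z hz hyz
      refine Metric.ball_disjoint_ball ?_
      have := hS y hy z hz hyz
      linarith
    · exact fun _ _ => measurableSet_ball
  have h3 : (S.card : ℝ≥0∞) * V ≤ c * V := by
    calc (S.card : ℝ≥0∞) * V = ∑ y ∈ S, V := by rw [Finset.sum_const, nsmul_eq_mul]
      _ ≤ ∑ y ∈ S, c * μ (Metric.ball y (ρ / 2)) := Finset.sum_le_sum h1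
      _ = c * ∑ y ∈ S, μ (Metric.ball y (ρ / 2)) := by rw [Finset.mul_sum]
      _ ≤ c * V := by gcongr
  have h4 : (S.card : ℝ≥0∞) ≤ c := (ENNReal.mul_le_mul_iff_left hV0 hVt).1 h3
  rw [hc, ← ENNReal.ofReal_natCast, ENNReal.ofReal_le_ofReal_iff (by positivity)] at h4
  exact h4

/-- A bounded set has a finite `ρ`-net that is `ρ`-separated: a separated subset of largest
cardinality. -/
theorem IsHomogeneousType.exists_finset_net (h : IsHomogeneousType μ n A) (hA : 0 ≤ A) {ρ : ℝ}
    (hρ : 0 < ρ) {Z : Set X} {x : X} {R : ℝ} (hR : 0 ≤ R) (hZ : Z ⊆ Metric.ball x R) :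
    ∃ S : Finset X, (∀ x ∈ S, ∀ y ∈ S, x ≠ y → ρ ≤ dist x y) ∧ ∀ z ∈ Z, ∃ y ∈ S, dist z y < ρ := by
  classical
  let P : Finset X → Prop := fun S => (S : Set X) ⊆ Z ∧ ∀ x ∈ S, ∀ y ∈ S, x ≠ y → ρ ≤ dist x y
  have hbdd : BddAbove {k : ℕ | ∃ S, P S ∧ S.card = k} := by
    refine ⟨⌈A * (4 * (R / ρ) + 2) ^ n⌉₊, ?_⟩
    rintro k ⟨S, ⟨hSZ, hS⟩, rfl⟩
    refine Nat.cast_le.1 ((h.card_separated_le hA hρ hS (x := x) (l := R / ρ) (by positivity)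
      fun y hy => ?_).trans (Nat.le_ceil _))
    rw [div_mul_cancel₀ _ hρ.ne', dist_comm]
    exact hZ (hSZ hy)
  obtain ⟨S, hS, hcard⟩ := Nat.sSup_mem (s := {k : ℕ | ∃ S, P S ∧ S.card = k})
    ⟨0, ∅, ⟨by simp, by simp⟩, rfl⟩ hbdd
  refine ⟨S, hS.2, fun z hz => ?_⟩
  by_contra! hcon
  have hzS : z ∉ S := fun hzS => by
    have := hcon z hzS
    rw [dist_self] at this
    linarith
  have hP : P (insert z S) := by
    refine ⟨?_, ?_⟩
    · rw [Finset.coe_insert]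
      exact insert_subset hz hS.1
    · intro x hx y hy hxy
      rcases Finset.mem_insert.1 hx with hx' | hx'
      · rcases Finset.mem_insert.1 hy with hy' | hy'
        · exact absurd (hx'.trans hy'.symm) hxy
        · rw [hx']; exact hcon y hy'
      · rcases Finset.mem_insert.1 hy with hy' | hy'
        · rw [hy', dist_comm]; exact hcon x hx'
        · exact hS.2 x hx' y hy' hxy
  have := le_csSup hbdd ⟨insert z S, hP, rfl⟩
  rw [← hcard, Finset.card_insert_of_notMem hzS] at this
  omega

/-- A bound, depending only on the homogeneity constants, for the sums of
`exp (-a dist(x, y) / ρ)` over `ρ`-separated sets. -/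
noncomputable def separatedExpSum (A n a : ℝ) : ℝ :=
  ∑' l : ℕ, A * (4 * ((l : ℝ) + 1) + 2) ^ n * Real.exp (-(a * l))

theorem summable_separatedExpSum {A n a : ℝ} (hA : 0 ≤ A) (ha : 0 < a) :
    Summable fun l : ℕ => A * (4 * ((l : ℝ) + 1) + 2) ^ n * Real.exp (-(a * l)) := by
  have h1 := (summable_nat_add_iff 1).2 (Real.summable_pow_mul_exp_neg_nat_mul ⌈n⌉₊ ha)
  refine Summable.of_nonneg_of_le (fun l => by positivity) (fun l => ?_)
    (h1.mul_left (A * 6 ^ ⌈n⌉₊ * Real.exp a))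
  have h2 : (4 * ((l : ℝ) + 1) + 2) ^ n ≤ (6 * ((l : ℝ) + 1)) ^ ⌈n⌉₊ := by
    have hl : (0 : ℝ) ≤ l := Nat.cast_nonneg l
    calc (4 * ((l : ℝ) + 1) + 2) ^ n ≤ (4 * ((l : ℝ) + 1) + 2) ^ (⌈n⌉₊ : ℝ) :=
          Real.rpow_le_rpow_of_exponent_le (by linarith) (Nat.le_ceil n)
      _ ≤ _ := by
        rw [Real.rpow_natCast]
        gcongr
        linarith
  have h3 : Real.exp (-(a * l)) = Real.exp a * Real.exp (-a * (l + 1)) := by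
    rw [← Real.exp_add]; ring_nf
  rw [h3]
  push_cast
  calc A * (4 * ((l : ℝ) + 1) + 2) ^ n * (Real.exp a * Real.exp (-a * (l + 1)))
      ≤ A * (6 * ((l : ℝ) + 1)) ^ ⌈n⌉₊ * (Real.exp a * Real.exp (-a * (l + 1))) := by gcongr
    _ = _ := by rw [mul_pow]; ring

theorem separatedExpSum_nonneg {A n a : ℝ} (hA : 0 ≤ A) : 0 ≤ separatedExpSum A n a :=
  tsum_nonneg fun l => by positivity

/-- The points are counted in the annuli `l ρ ≤ dist x y < (l + 1) ρ`. -/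
theorem IsHomogeneousType.sum_exp_le (h : IsHomogeneousType μ n A) (hA : 0 ≤ A) {a ρ : ℝ}
    (ha : 0 < a) (hρ : 0 < ρ) {S : Finset X} (hS : ∀ x ∈ S, ∀ y ∈ S, x ≠ y → ρ ≤ dist x y) (x : X) :
    ∑ y ∈ S, Real.exp (-(a * (dist x y / ρ))) ≤ separatedExpSum A n a := by
  classical
  let g : X → ℕ := fun y => ⌊dist x y / ρ⌋₊
  calc ∑ y ∈ S, Real.exp (-(a * (dist x y / ρ))) ≤ ∑ y ∈ S, Real.exp (-(a * (g y : ℝ))) := by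
        refine Finset.sum_le_sum fun y _ => Real.exp_le_exp.2 ?_
        have : (g y : ℝ) ≤ dist x y / ρ := Nat.floor_le (by positivity)
        nlinarith
    _ = ∑ l ∈ S.image g, (S.filter fun y => g y = l).card • Real.exp (-(a * (l : ℝ))) :=
        Finset.sum_comp (fun l : ℕ => Real.exp (-(a * (l : ℝ)))) g
    _ ≤ ∑ l ∈ S.image g, A * (4 * ((l : ℝ) + 1) + 2) ^ n * Real.exp (-(a * l)) := by
        refine Finset.sum_le_sum fun l _ => ?_
        rw [nsmul_eq_mul]
        refine mul_le_mul_of_nonneg_right ?_ (Real.exp_pos _).le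
        refine h.card_separated_le hA hρ (fun y hy z hz => ?_) (x := x) (by positivity) fun y hy => ?_
        · exact hS y (Finset.mem_filter.1 hy).1 z (Finset.mem_filter.1 hz).1
        · rw [← div_lt_iff₀ hρ, ← (Finset.mem_filter.1 hy).2]
          exact Nat.lt_floor_add_one _
    _ ≤ separatedExpSum A n a :=
        (summable_separatedExpSum hA ha).sum_le_tsum _ fun l _ => by positivity

end Separated

/-! ### Off-diagonal estimates between arbitrary bounded sets -/

section OffDiagonal

variable {X : Type*} [MetricSpace X] [MeasurableSpace X] [BorelSpace X] {μ : Measure X} {n A : ℝ}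

theorem le_rpow_add_one {u p : ℝ} (hu : 0 ≤ u) (hp : 1 ≤ p) : u ≤ u ^ p + 1 := by
  rcases le_total u 1 with h | h
  · linarith [Real.rpow_nonneg hu p]
  · have := Real.rpow_le_rpow_of_exponent_le h hp
    rw [Real.rpow_one] at this
    linarith

/-- Splitting of the Gaussian-type weight into a summable factor and the decay in the distance `D`
of the two sets, for cells whose centres are `u` units apart. -/
theorem exp_neg_rpow_le {a p u D : ℝ} (ha : 0 ≤ a) (hp1 : 1 ≤ p) (hp2 : p ≤ 2) (hu : 0 ≤ u)
    (hD : 0 ≤ D) (hDu : D ≤ u + 2) :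
    Real.exp (-(a * u ^ p)) ≤
      Real.exp (5 * a / 2) * Real.exp (-(a / 8 * D ^ p)) * Real.exp (-(a / 2 * u)) := by
  have h1 := le_rpow_add_one hu hp1
  have h2 : D ^ p ≤ 4 * u ^ p + 16 := by
    have h3 : D ^ p ≤ (u + 2) ^ p := Real.rpow_le_rpow hD hDu (by linarith)
    have hb : ∀ x : ℝ, 1 ≤ x → x ^ p ≤ x ^ 2 := fun x hx => by
      rw [← Real.rpow_natCast]
      exact Real.rpow_le_rpow_of_exponent_le hx (by exact_mod_cast hp2)
    rcases le_total u 2 with h | h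
    · have h4 : (u + 2) ^ p ≤ 4 ^ p := Real.rpow_le_rpow (by linarith) (by linarith) (by linarith)
      have := hb 4 (by norm_num)
      linarith [Real.rpow_nonneg hu p]
    · have h4 : (u + 2) ^ p ≤ (2 * u) ^ p :=
        Real.rpow_le_rpow (by linarith) (by linarith) (by linarith)
      rw [Real.mul_rpow (by norm_num) hu] at h4
      have := hb 2 (by norm_num)
      nlinarith [Real.rpow_nonneg hu p]
  rw [← Real.exp_add, ← Real.exp_add]
  refine Real.exp_le_exp.2 ?_
  nlinarith

/-- Schur's test for a finite matrix with non-negative entries. -/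
theorem sum_mul_le_of_sum_le {ι : Type*} [Fintype ι] {k : ι → ι → ℝ} {σ : ℝ}
    (hk : ∀ i j, 0 ≤ k i j) (hrow : ∀ i, ∑ j, k i j ≤ σ) (hcol : ∀ j, ∑ i, k i j ≤ σ)
    (x y : ι → ℝ) :
    ∑ i, ∑ j, k i j * (x i * y j) ≤ σ / 2 * (∑ i, x i ^ 2 + ∑ j, y j ^ 2) := by
  calc ∑ i, ∑ j, k i j * (x i * y j)
      ≤ ∑ i, ∑ j, (1 / 2 * (x i ^ 2 * k i j) + 1 / 2 * (y j ^ 2 * k i j)) := by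
        refine Finset.sum_le_sum fun i _ => Finset.sum_le_sum fun j _ => ?_
        nlinarith [mul_nonneg (hk i j) (sq_nonneg (x i - y j))]
    _ = 1 / 2 * ∑ i, x i ^ 2 * ∑ j, k i j + 1 / 2 * ∑ j, y j ^ 2 * ∑ i, k i j := by
        simp only [Finset.sum_add_distrib, Finset.mul_sum]
        congr 1
        exact Finset.sum_comm
    _ ≤ 1 / 2 * ∑ i, x i ^ 2 * σ + 1 / 2 * ∑ j, y j ^ 2 * σ := by
        gcongr with i _ j _
        · exact hrow i
        · exact hcol j
    _ = σ / 2 * (∑ i, x i ^ 2 + ∑ j, y j ^ 2) := by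
        rw [← Finset.sum_mul, ← Finset.sum_mul]; ring

/-- Estimates between balls of radius `ρ` imply estimates between arbitrary bounded sets: both sets
are cut into cells of diameter at most `2ρ` around a `ρ`-separated net, and the resulting matrix of
operators is bounded by Schur's test. -/
theorem IsHomogeneousType.norm_restrictProj_mul_le (h : IsHomogeneousType μ n A) (hA : 0 ≤ A)
    {T : Lp ℂ 2 μ →L[ℂ] Lp ℂ 2 μ} {a b p ρ D : ℝ} (ha : 0 < a) (hb : 0 ≤ b) (hρ : 0 < ρ)
    (hp1 : 1 ≤ p) (hp2 : p ≤ 2)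
    (hT : ∀ x y, ‖ballProj μ x ρ * T * ballProj μ y ρ‖ ≤ b * Real.exp (-(a * (dist x y / ρ) ^ p)))
    {E F : Set X} (hE : MeasurableSet E) (hF : MeasurableSet F) {x₀ : X} {R : ℝ} (hR : 0 ≤ R)
    (hEb : E ⊆ Metric.ball x₀ R) (hFb : F ⊆ Metric.ball x₀ R) (hD0 : 0 ≤ D)
    (hD : ∀ x ∈ E, ∀ y ∈ F, D ≤ dist x y) :
    ‖restrictProj μ hE * T * restrictProj μ hF‖ ≤
      b * Real.exp (5 * a / 2) * separatedExpSum A n (a / 2) *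
        Real.exp (-(a / 8 * (D / ρ) ^ p)) := by
  classical
  obtain ⟨S, hS, hcov⟩ := h.exists_finset_net hA hρ hR (union_subset hEb hFb)
  let c : Fin S.card → X := fun i => (S.equivFin.symm i : X)
  let Q : Fin S.card → Set X := disjointed fun i => Metric.ball (c i) ρ
  have hQm : ∀ i, MeasurableSet (Q i) := fun i => by
    change MeasurableSet (disjointed _ i)
    rw [disjointed_eq_inter_compl]
    exact measurableSet_ball.inter
      (MeasurableSet.iInter fun j => MeasurableSet.iInter fun _ => measurableSet_ball.compl)
  have hQd : Pairwise fun i j => Disjoint (Q i) (Q j) := disjoint_disjointed _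
  have hQb : ∀ i, Q i ⊆ Metric.ball (c i) ρ := fun i => disjointed_subset _ i
  have hQc : E ∪ F ⊆ ⋃ i, Q i := by
    change _ ⊆ ⋃ i, disjointed _ i
    rw [iUnion_disjointed]
    intro z hz
    obtain ⟨y, hy, hzy⟩ := hcov z hz
    refine mem_iUnion.2 ⟨S.equivFin ⟨y, hy⟩, ?_⟩
    simpa [c] using hzy
  have hEm : ∀ i, MeasurableSet (E ∩ Q i) := fun i => hE.inter (hQm i)
  have hFm : ∀ i, MeasurableSet (F ∩ Q i) := fun i => hF.inter (hQm i)
  have hEd : Pairwise fun i j => Disjoint (E ∩ Q i) (E ∩ Q j) := fun i j hij =>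
    (hQd hij).mono inter_subset_right inter_subset_right
  have hFd : Pairwise fun i j => Disjoint (F ∩ Q i) (F ∩ Q j) := fun i j hij =>
    (hQd hij).mono inter_subset_right inter_subset_right
  have hEU : E = ⋃ i, E ∩ Q i := by
    rw [← inter_iUnion, inter_eq_left.2 (subset_union_left.trans hQc)]
  have hFU : F = ⋃ i, F ∩ Q i := by
    rw [← inter_iUnion, inter_eq_left.2 (subset_union_right.trans hQc)]
  set W : ℝ := b * Real.exp (5 * a / 2) * Real.exp (-(a / 8 * (D / ρ) ^ p)) with hW
  have hW0 : 0 ≤ W := by positivity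
  set σ₀ := separatedExpSum A n (a / 2) with hσ
  have hσ0 : 0 ≤ σ₀ := separatedExpSum_nonneg hA
  let k : Fin S.card → Fin S.card → ℝ := fun i j => Real.exp (-(a / 2 * (dist (c i) (c j) / ρ)))
  have hrow : ∀ i, ∑ j, k i j ≤ σ₀ := by
    intro i
    have h1 := h.sum_exp_le hA (half_pos ha) hρ hS (c i)
    rw [← Finset.sum_coe_sort, ← S.equivFin.symm.sum_comp] at h1
    exact h1
  have hcol : ∀ j, ∑ i, k i j ≤ σ₀ := by
    intro j
    refine le_trans (le_of_eq (Finset.sum_congr rfl fun i _ => ?_)) (hrow j)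
    simp only [k, dist_comm]
  have hterm : ∀ (g f : Lp ℂ 2 μ) i j,
      ‖inner ℂ g (restrictProj μ (hEm i) (T (restrictProj μ (hFm j) f)))‖ ≤
        W * k i j * (‖restrictProj μ (hEm i) g‖ * ‖restrictProj μ (hFm j) f‖) := by
    intro g f i j
    have hE1 := restrictProj_mul_restrictProj (μ := μ) (hEm i) (hEm i) Subset.rfl
    have hE2 := restrictProj_mul_restrictProj (μ := μ) (hEm i)
      (measurableSet_ball : MeasurableSet (Metric.ball (c i) ρ)) (inter_subset_right.trans (hQb i))
    have hF2 := restrictProj_mul_restrictProj' (μ := μ) (hFm j)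
      (measurableSet_ball : MeasurableSet (Metric.ball (c j) ρ)) (inter_subset_right.trans (hQb j))
    rcases (E ∩ Q i).eq_empty_or_nonempty with he | ⟨x, hx⟩
    · rw [restrictProj_eq_zero (hEm i) he]
      simp
    rcases (F ∩ Q j).eq_empty_or_nonempty with he | ⟨y, hy⟩
    · rw [restrictProj_eq_zero (hFm j) he]
      simp
    have hdist : D / ρ ≤ dist (c i) (c j) / ρ + 2 := by
      rw [div_add' _ _ _ hρ.ne', div_le_div_iff_of_pos_right hρ]
      have h1 := hD x hx.1 y hy.1
      have h2 : dist x (c i) < ρ := hQb i hx.2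
      have h3 : dist y (c j) < ρ := hQb j hy.2
      have h4 := dist_triangle4 x (c i) (c j) y
      rw [dist_comm (c j) y] at h4
      linarith
    have hop : ‖ballProj μ (c i) ρ * T * ballProj μ (c j) ρ‖ ≤ W * k i j := by
      refine (hT _ _).trans ?_
      have := exp_neg_rpow_le ha.le hp1 hp2 (u := dist (c i) (c j) / ρ) (by positivity)
        (div_nonneg hD0 hρ.le) hdist
      calc b * Real.exp (-(a * (dist (c i) (c j) / ρ) ^ p)) ≤ b * _ :=
            mul_le_mul_of_nonneg_left this hb
        _ = W * k i j := by simp only [hW, k]; ring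
    have hE2' : ∀ u, restrictProj μ (hEm i) u = restrictProj μ (hEm i) (ballProj μ (c i) ρ u) :=
      fun u => (congrArg (fun V : Lp ℂ 2 μ →L[ℂ] Lp ℂ 2 μ => V u) hE2).symm
    have hF2' : restrictProj μ (hFm j) f = ballProj μ (c j) ρ (restrictProj μ (hFm j) f) :=
      (congrArg (fun V : Lp ℂ 2 μ →L[ℂ] Lp ℂ 2 μ => V f) hF2).symm
    rw [hE2', ← inner_restrictProj_left]
    refine (norm_inner_le_norm _ _).trans ?_
    have h5 := (ballProj μ (c i) ρ * T * ballProj μ (c j) ρ).le_of_opNorm_le hop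
      (restrictProj μ (hFm j) f)
    rw [mul_apply_eq_comp, mul_apply_eq_comp, ← hF2'] at h5
    calc _ ≤ ‖restrictProj μ (hEm i) g‖ * (W * k i j * ‖restrictProj μ (hFm j) f‖) :=
          mul_le_mul_of_nonneg_left h5 (norm_nonneg _)
      _ = _ := by ring
  have hgoal : ‖restrictProj μ hE * T * restrictProj μ hF‖ ≤ 2 * (W * σ₀ / 2) := by
    refine ContinuousLinearMap.opNorm_le_of_norm_inner_le (by positivity) fun g f => ?_
    have hsum : inner ℂ g ((restrictProj μ hE * T * restrictProj μ hF) f) =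
        ∑ i, ∑ j, inner ℂ g (restrictProj μ (hEm i) (T (restrictProj μ (hFm j) f))) := by
      rw [mul_apply_eq_comp, mul_apply_eq_comp,
        restrictProj_eq_sum hE hEm hEd hEU, restrictProj_eq_sum hF hFm hFd hFU]
      simp only [_root_.sum_apply, map_sum, inner_sum]
      exact Finset.sum_comm
    rw [hsum]
    calc ‖∑ i, ∑ j, inner ℂ g (restrictProj μ (hEm i) (T (restrictProj μ (hFm j) f)))‖
        ≤ ∑ i, ∑ j, ‖inner ℂ g (restrictProj μ (hEm i) (T (restrictProj μ (hFm j) f)))‖ :=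
          (norm_sum_le _ _).trans (Finset.sum_le_sum fun i _ => norm_sum_le _ _)
      _ ≤ ∑ i, ∑ j, W * (k i j * (‖restrictProj μ (hEm i) g‖ * ‖restrictProj μ (hFm j) f‖)) :=
          Finset.sum_le_sum fun i _ => Finset.sum_le_sum fun j _ =>
            (hterm g f i j).trans (le_of_eq (mul_assoc _ _ _))
      _ = W * ∑ i, ∑ j, k i j * (‖restrictProj μ (hEm i) g‖ * ‖restrictProj μ (hFm j) f‖) := by
          simp only [Finset.mul_sum]
      _ ≤ W * (σ₀ / 2 * (∑ i, ‖restrictProj μ (hEm i) g‖ ^ 2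
            + ∑ j, ‖restrictProj μ (hFm j) f‖ ^ 2)) :=
          mul_le_mul_of_nonneg_left
            (sum_mul_le_of_sum_le (fun i j => (Real.exp_pos _).le) hrow hcol _ _) hW0
      _ ≤ W * (σ₀ / 2 * (‖g‖ ^ 2 + ‖f‖ ^ 2)) := by
          refine mul_le_mul_of_nonneg_left (mul_le_mul_of_nonneg_left (add_le_add ?_ ?_)
            (by positivity)) hW0
          · exact sum_norm_restrictProj_sq_le hE hEm hEd hEU g
          · exact sum_norm_restrictProj_sq_le hF hFm hFd hFU f
      _ = W * σ₀ / 2 * (‖g‖ ^ 2 + ‖f‖ ^ 2) := by ring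
  refine hgoal.trans (le_of_eq ?_)
  rw [hW]
  ring

end OffDiagonal

/-! ### Uniform decay of Fourier transforms -/

section FourierDecay

open FourierTransform

theorem integrable_mul_cexp {ψ : ℝ → ℂ} (hψ : Continuous ψ) (hs : HasCompactSupport ψ) (s : ℂ) :
    Integrable fun l : ℝ => ψ l * Complex.exp (-(s * l)) :=
  Continuous.integrable_of_hasCompactSupport (by fun_prop) hs.mul_right

/-- Repeated integration by parts in the Laplace transform of a test function supported in
`[1/4, 4]`; the exponential stays bounded on the support for `Re s ≥ -1`. -/
theorem exists_norm_pow_mul_laplace_le (N : ℕ) :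
    ∀ ψ : ℝ → ℂ, ContDiff ℝ ((⊤ : ℕ∞) : WithTop ℕ∞) ψ → tsupport ψ ⊆ Icc (1 / 4) 4 →
      ∃ C : ℝ, 0 ≤ C ∧ ∀ s : ℂ, -1 ≤ s.re →
        ‖s‖ ^ N * ‖∫ l : ℝ, ψ l * Complex.exp (-(s * l))‖ ≤ C := by
  induction N with
  | zero =>
    intro ψ hψ hsupp
    have hcs : HasCompactSupport ψ := isCompact_Icc.of_isClosed_subset (isClosed_tsupport ψ) hsupp
    have hi : Integrable ψ := hψ.continuous.integrable_of_hasCompactSupport hcs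
    refine ⟨∫ l, ‖ψ l‖ * Real.exp 4, integral_nonneg fun l => by positivity, fun s hs => ?_⟩
    rw [pow_zero, one_mul]
    refine norm_integral_le_of_norm_le (hi.norm.mul_const _) (Filter.Eventually.of_forall fun l => ?_)
    rw [norm_mul, Complex.norm_exp]
    by_cases hl : ψ l = 0
    · simp [hl]
    have hl' := hsupp (subset_tsupport _ hl)
    refine mul_le_mul_of_nonneg_left (Real.exp_le_exp.2 ?_) (norm_nonneg _)
    simp only [Complex.neg_re, Complex.mul_re, Complex.ofReal_re, Complex.ofReal_im, mul_zero,
      sub_zero]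
    nlinarith [hl'.1, hl'.2]
  | succ N ih =>
    intro ψ hψ hsupp
    have hcs : HasCompactSupport ψ := isCompact_Icc.of_isClosed_subset (isClosed_tsupport ψ) hsupp
    have hd : ContDiff ℝ ((⊤ : ℕ∞) : WithTop ℕ∞) (deriv ψ) :=
      (contDiff_infty_iff_deriv.1 hψ).2
    have hdiff : Differentiable ℝ ψ := (contDiff_infty_iff_deriv.1 hψ).1
    obtain ⟨C, hC0, hC⟩ := ih (deriv ψ) hd (tsupport_deriv_subset.trans hsupp)
    refine ⟨C, hC0, fun s hs => le_trans (le_of_eq ?_) (hC s hs)⟩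
    have hparts : ∫ l : ℝ, ψ l * (-s * Complex.exp (-(s * l)))
        = -∫ l : ℝ, deriv ψ l * Complex.exp (-(s * l)) := by
      refine integral_mul_deriv_eq_deriv_mul_of_integrable (fun l _ => (hdiff l).hasDerivAt)
        (fun l _ => ?_) ?_ (integrable_mul_cexp hd.continuous hcs.deriv s)
        (integrable_mul_cexp hψ.continuous hcs s)
      · have h1 : HasDerivAt (fun l : ℝ => -(s * (l : ℂ))) (-(s * 1)) l :=
          ((Complex.ofRealCLM.hasDerivAt (x := l)).const_mul s).neg
        have h2 := h1.cexp
        rw [mul_one, mul_comm] at h2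
        exact h2
      · refine ((integrable_mul_cexp hψ.continuous hcs s).const_mul (-s)).congr
          (Filter.Eventually.of_forall fun l => ?_)
        simp only [Pi.mul_apply]
        ring
    have h3 : s * ∫ l : ℝ, ψ l * Complex.exp (-(s * l))
        = ∫ l : ℝ, deriv ψ l * Complex.exp (-(s * l)) := by
      rw [← neg_inj, ← hparts, ← neg_mul, ← integral_const_mul]
      refine integral_congr_ae (Filter.Eventually.of_forall fun l => ?_)
      ring
    rw [pow_succ, mul_assoc, ← norm_mul, h3]

/-- Multiplying a test function by `e^{(1-σ)l}` costs nothing in the decay of the Fourier transform,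
uniformly in `σ ≥ 0`. -/
theorem exists_norm_fourier_le {φ : ℝ → ℂ} (hφ : ContDiff ℝ ((⊤ : ℕ∞) : WithTop ℕ∞) φ)
    (hsupp : tsupport φ ⊆ Icc (1 / 4) 4) (N : ℕ) :
    ∃ C : ℝ, 0 ≤ C ∧ ∀ σ : ℝ, 0 ≤ σ → ∀ ξ : ℝ,
      (1 + |ξ|) ^ N * ‖𝓕 (fun l : ℝ => φ l * Complex.exp (-(((σ - 1 : ℝ) : ℂ) * l))) ξ‖ ≤ C := by
  obtain ⟨C₀, hC₀, h₀⟩ := exists_norm_pow_mul_laplace_le 0 φ hφ hsupp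
  obtain ⟨C₁, hC₁, h₁⟩ := exists_norm_pow_mul_laplace_le N φ hφ hsupp
  refine ⟨2 ^ (N - 1) * (C₀ + C₁), by positivity, fun σ hσ ξ => ?_⟩
  set s : ℂ := ⟨σ - 1, 2 * Real.pi * ξ⟩ with hs
  have hF : 𝓕 (fun l : ℝ => φ l * Complex.exp (-(((σ - 1 : ℝ) : ℂ) * l))) ξ
      = ∫ l : ℝ, φ l * Complex.exp (-(s * l)) := by
    rw [Real.fourier_real_eq_integral_exp_smul]
    refine integral_congr_ae (Filter.Eventually.of_forall fun l => ?_)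
    simp only [smul_eq_mul]
    rw [mul_left_comm, ← Complex.exp_add]
    congr 2
    apply Complex.ext <;> simp [hs]
    ring
  rw [hF]
  have hre : -1 ≤ s.re := by simp [hs]; linarith
  have hξ : |ξ| ≤ ‖s‖ := by
    refine le_trans ?_ (Complex.abs_im_le_norm s)
    simp only [hs, abs_mul, abs_of_pos Real.pi_pos, abs_two]
    nlinarith [Real.pi_gt_three, abs_nonneg ξ]
  have e0 := h₀ s hre
  have e1 := h₁ s hre
  rw [pow_zero, one_mul] at e0
  set I := ‖∫ l : ℝ, φ l * Complex.exp (-(s * l))‖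
  have hI : 0 ≤ I := norm_nonneg _
  calc (1 + |ξ|) ^ N * I ≤ 2 ^ (N - 1) * (1 ^ N + |ξ| ^ N) * I := by
        gcongr
        exact add_pow_le zero_le_one (abs_nonneg _) N
    _ ≤ 2 ^ (N - 1) * (1 ^ N + ‖s‖ ^ N) * I := by gcongr
    _ = 2 ^ (N - 1) * (I + ‖s‖ ^ N * I) := by ring
    _ ≤ 2 ^ (N - 1) * (C₀ + C₁) := by gcongr

/-- Fourier inversion for the modulated test functions, together with a weighted `L¹` bound on the
transform that is uniform in `σ ≥ 0`. -/
theorem exists_fourier_superposition {φ : ℝ → ℂ} (hφ : ContDiff ℝ ((⊤ : ℕ∞) : WithTop ℕ∞) φ)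
    (hsupp : tsupport φ ⊆ Icc (1 / 4) 4) (N : ℕ) :
    ∃ C : ℝ, 0 ≤ C ∧ ∀ σ : ℝ, 0 ≤ σ → ∃ w : ℝ → ℂ, Integrable w ∧
      Integrable (fun ξ => ‖w ξ‖ * (1 + |ξ|) ^ N) ∧ ∫ ξ, ‖w ξ‖ * (1 + |ξ|) ^ N ≤ C ∧
      ∀ l : ℝ, φ l * Complex.exp (-(((σ - 1 : ℝ) : ℂ) * l)) =
        ∫ ξ, w ξ * Complex.exp (Complex.I * ((2 * Real.pi * ξ * l : ℝ) : ℂ)) := by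
  obtain ⟨C, hC0, hC⟩ := exists_norm_fourier_le hφ hsupp (N + 2)
  have hint : Integrable fun ξ : ℝ => (1 + ‖ξ‖) ^ (-(2 : ℝ)) :=
    integrable_one_add_norm (by simp)
  refine ⟨∫ ξ : ℝ, C * (1 + ‖ξ‖) ^ (-(2 : ℝ)), integral_nonneg fun ξ => by positivity,
    fun σ hσ => ?_⟩
  have hcs : HasCompactSupport φ := isCompact_Icc.of_isClosed_subset (isClosed_tsupport φ) hsupp
  set g : ℝ → ℂ := fun l : ℝ => φ l * Complex.exp (-(((σ - 1 : ℝ) : ℂ) * l)) with hg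
  have hgc : Continuous g := by have := hφ.continuous; fun_prop
  have hgi : Integrable g := integrable_mul_cexp hφ.continuous hcs _
  have hFc : Continuous (𝓕 g) :=
    VectorFourier.fourierIntegral_continuous Real.continuous_fourierChar
      (by exact continuous_inner) hgi
  have hb : ∀ ξ : ℝ, ‖𝓕 g ξ‖ * (1 + |ξ|) ^ N ≤ C * (1 + ‖ξ‖) ^ (-(2 : ℝ)) := by
    intro ξ
    have h1 := hC σ hσ ξ
    have hp : 0 < 1 + |ξ| := by positivity
    rw [Real.rpow_neg (by positivity), Real.norm_eq_abs, ← div_eq_mul_inv, le_div_iff₀ (by positivity),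
      show (2 : ℝ) = ((2 : ℕ) : ℝ) by norm_num, Real.rpow_natCast]
    rw [pow_add] at h1
    linarith
  have hwi : Integrable fun ξ : ℝ => ‖𝓕 g ξ‖ * (1 + |ξ|) ^ N := by
    refine (hint.const_mul C).mono' (by fun_prop) (Filter.Eventually.of_forall fun ξ => ?_)
    rw [Real.norm_of_nonneg (by positivity)]
    exact hb ξ
  have hFi : Integrable (𝓕 g) := by
    refine hwi.mono' hFc.aestronglyMeasurable (Filter.Eventually.of_forall fun ξ => ?_)
    exact le_mul_of_one_le_right (norm_nonneg _) (one_le_pow₀ (by linarith [abs_nonneg ξ]))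
  refine ⟨𝓕 g, hFi, hwi, integral_mono hwi (hint.const_mul C) hb, fun l => ?_⟩
  have hinv := congrFun (hgc.fourierInv_fourier_eq hgi hFi) l
  rw [Real.fourierInv_eq'] at hinv
  refine hinv.symm.trans (integral_congr_ae (Filter.Eventually.of_forall fun ξ => ?_))
  simp only [smul_eq_mul, RCLike.inner_apply, conj_trivial]
  rw [mul_comm, mul_comm Complex.I]
  congr 4
  ring

end FourierDecay

section ExpRpow

/-- Superpolynomial decay of `exp (-κ v^p)`, `p ≥ 1`. -/
theorem exists_exp_neg_rpow_mul_pow_le {κ p : ℝ} (hκ : 0 < κ) (hp : 1 ≤ p) (N : ℕ) :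
    ∃ C : ℝ, 0 ≤ C ∧ ∀ v : ℝ, 0 ≤ v → Real.exp (-(κ * v ^ p)) * (1 + v) ^ N ≤ C := by
  refine ⟨Real.exp (2 * κ) * (N.factorial / κ ^ N), by positivity, fun v hv => ?_⟩
  have h1 := le_rpow_add_one hv hp
  have h2 := Real.pow_div_factorial_le_exp (κ * (1 + v)) (by positivity) N
  have hf : (0 : ℝ) < N.factorial := by exact_mod_cast N.factorial_pos
  rw [div_le_iff₀ hf, mul_pow] at h2
  have h3 : (1 + v) ^ N ≤ Real.exp (κ * (1 + v)) * (N.factorial / κ ^ N) := by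
    rw [← mul_div_assoc, le_div_iff₀ (by positivity)]
    linarith
  calc Real.exp (-(κ * v ^ p)) * (1 + v) ^ N
      ≤ Real.exp (-(κ * v ^ p)) * (Real.exp (κ * (1 + v)) * (N.factorial / κ ^ N)) := by gcongr
    _ = Real.exp (-(κ * v ^ p) + κ * (1 + v)) * (N.factorial / κ ^ N) := by
        rw [Real.exp_add]; ring
    _ ≤ Real.exp (2 * κ) * (N.factorial / κ ^ N) := by
        gcongr
        nlinarith

end ExpRpow

/-! ### The heat semigroup at complex times -/

section ComplexHeat

variable {H : Type*} [NormedAddCommGroup H] [InnerProductSpace ℂ H] [CompleteSpace H]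

namespace ProjectionValuedMeasure

variable {E : ProjectionValuedMeasure H}

/-- The operator `e^{-zL}`, where `E` is the spectral resolution of `L`. -/
noncomputable def complexHeat (E : ProjectionValuedMeasure H) (z : ℂ) : H →L[ℂ] H :=
  E.integral fun l => Complex.exp (-(z * l))

theorem norm_cexp_neg_mul_le {z : ℂ} (hz : 0 ≤ z.re) (l : ℝ) (hl : 0 ≤ l) :
    ‖Complex.exp (-(z * l))‖ ≤ 1 := by
  rw [Complex.norm_exp, Real.exp_le_one_iff]
  simp only [Complex.neg_re, Complex.mul_re, Complex.ofReal_re, Complex.ofReal_im, mul_zero,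
    sub_zero]
  nlinarith [mul_nonneg hz hl]

theorem represents_complexHeat (hE : E.proj (Iio 0) = 0) {z : ℂ} (hz : 0 ≤ z.re) :
    E.Represents (fun l => Complex.exp (-(z * l))) (E.complexHeat z) :=
  represents_integral hE (by fun_prop) (norm_cexp_neg_mul_le hz)

theorem norm_complexHeat_le (hE : E.proj (Iio 0) = 0) {z : ℂ} (hz : 0 ≤ z.re) :
    ‖E.complexHeat z‖ ≤ 2 := by
  simpa using (represents_complexHeat hE hz).norm_le_of_nonneg hE (norm_cexp_neg_mul_le hz)

/-- On the diagonal, `⟨f, e^{-zL} f⟩` is the Laplace transform of the scalar spectral measure. -/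
theorem differentiableAt_inner_self_complexHeat (hE : E.proj (Iio 0) = 0) (f : H) {z : ℂ}
    (hz : 0 < z.re) : DifferentiableAt ℂ (fun z => inner ℂ f (E.complexHeat z f)) z := by
  have hsub : Ioi (0 : ℝ) ⊆
      interior (ProbabilityTheory.integrableExpSet (fun l : ℝ => -l) (E.scalarMeasure f)) := by
    refine interior_maximal (fun t ht => ?_) isOpen_Ioi
    refine Integrable.of_bound (by fun_prop) 1 ?_
    filter_upwards [ae_nonneg_scalarMeasure hE f] with l hl
    rw [Real.norm_eq_abs, Real.abs_exp, Real.exp_le_one_iff]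
    nlinarith [mul_nonneg (le_of_lt (mem_Ioi.1 ht)) hl]
  refine (ProbabilityTheory.hasDerivAt_complexMGF (hsub hz)).differentiableAt.congr_of_eventuallyEq ?_
  filter_upwards [(isOpen_Ioi.preimage Complex.continuous_re).mem_nhds (mem_preimage.2 (mem_Ioi.2 hz))]
    with y hy
  rw [represents_complexHeat hE (le_of_lt hy) f, ProbabilityTheory.complexMGF]
  simp

theorem differentiableAt_inner_complexHeat (hE : E.proj (Iio 0) = 0) (g f : H) {z : ℂ}
    (hz : 0 < z.re) : DifferentiableAt ℂ (fun z => inner ℂ g (E.complexHeat z f)) z := by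
  have h := fun f => differentiableAt_inner_self_complexHeat hE f hz
  refine (((((h (g + f)).sub (h (g - f))).sub ((h (g + Complex.I • f)).const_mul Complex.I)).add
    ((h (g - Complex.I • f)).const_mul Complex.I)).div_const 4).congr_of_eventuallyEq ?_
  exact Filter.Eventually.of_forall fun z => inner_map_polarization_right _ g f

theorem represents_one : E.Represents (fun _ => 1) 1 := fun f => by
  rw [integral_const, E.scalarMeasure_real_univ, one_apply_eq_self, inner_self_eq_norm_sq_to_K]
  simp

theorem complexHeat_pow (hE : E.proj (Iio 0) = 0) {s : ℝ} (hs : 0 ≤ s) (j : ℕ) :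
    E.complexHeat s ^ j = E.complexHeat ((j * s : ℝ) : ℂ) := by
  refine (Represents.integral_eq ?_).symm
  induction j with
  | zero => simpa using represents_one
  | succ j ih =>
    rw [pow_succ]
    refine (Represents.mul hE ih (represents_complexHeat hE (z := s) (by simpa using hs))
      (by fun_prop) (by fun_prop) (norm_cexp_neg_mul_le ?_) (norm_cexp_neg_mul_le ?_)).congr
        fun f => Filter.Eventually.of_forall fun l => ?_
    · rw [Complex.ofReal_re]; positivity
    · simpa using hs
    · simp only [← Complex.exp_add]
      congr 1
      push_cast
      ring

end ProjectionValuedMeasure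

theorem heatSemigroup_eq_complexHeat (L : H →ₗ.[ℂ] H) (t : ℝ) :
    heatSemigroup L t = (spectralResolution L).complexHeat t := by
  unfold heatSemigroup borelCalc ProjectionValuedMeasure.complexHeat
  push_cast
  rfl

end ComplexHeat

/-! ### Off-diagonal estimates for the functional calculus -/

section MainEstimate

variable {X : Type*} [MetricSpace X] [MeasurableSpace X] [BorelSpace X] {μ : Measure X} {n A : ℝ}

open ProjectionValuedMeasure

/-- The constant in the complex-time off-diagonal estimates: the larger of the bound `2` for the
norm of `e^{-zL}` and the constant of the real-time estimates. -/
noncomputable def complexTimeConst (A n b a : ℝ) : ℝ :=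
  max 2 (b * Real.exp (5 * a / 2) * separatedExpSum A n (a / 2))

/-- Davies–Gaffney estimates at complex times, between arbitrary bounded sets. -/
theorem norm_inner_complexHeat_le {L : Lp ℂ 2 μ →ₗ.[ℂ] Lp ℂ 2 μ} {m b a : ℝ}
    (h : IsHomogeneousType μ n A) (hA : 0 ≤ A) (hm : 2 ≤ m) (ha : 0 < a) (hb : 0 ≤ b)
    (hL : IsNonnegOperator L) (hDG : DaviesGaffney μ L m b a)
    {E F : Set X} (hE : MeasurableSet E) (hF : MeasurableSet F) {x₀ : X} {R : ℝ} (hR : 0 ≤ R)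
    (hEb : E ⊆ Metric.ball x₀ R) (hFb : F ⊆ Metric.ball x₀ R) {D : ℝ} (hD0 : 0 ≤ D)
    (hD : ∀ x ∈ E, ∀ y ∈ F, D ≤ dist x y) (g f : Lp ℂ 2 μ) {z : ℂ} (hz : 0 < z.re) :
    ‖inner ℂ (restrictProj μ hE g)
        ((spectralResolution L).complexHeat z (restrictProj μ hF f))‖ ≤
      complexTimeConst A n b a * ‖g‖ * ‖f‖ *
        Real.exp (-(a / (16 * (m - 1)) * (D ^ (m / (m - 1)) * z.re / ‖z‖ ^ (m / (m - 1))))) := by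
  have hsp := spectralResolution_proj_Iio_zero hL
  have hm1 : 0 < m - 1 := by linarith
  have hm0 : 0 < m := by linarith
  have hpα : 1 + 1 / (m - 1) = m / (m - 1) := by field_simp; ring
  have hp1 : 1 ≤ m / (m - 1) := by rw [le_div_iff₀ hm1]; linarith
  have hp2 : m / (m - 1) ≤ 2 := by rw [div_le_iff₀ hm1]; linarith
  have hα1 : 1 / (m - 1) ≤ 1 := by rw [div_le_one hm1]; linarith
  have hnE : ∀ u, ‖restrictProj μ hE u‖ ≤ ‖u‖ := fun u => by
    simpa using (restrictProj μ hE).le_of_opNorm_le (norm_restrictProj_le hE) u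
  have hnF : ∀ u, ‖restrictProj μ hF u‖ ≤ ‖u‖ := fun u => by
    simpa using (restrictProj μ hF).le_of_opNorm_le (norm_restrictProj_le hF) u
  have key := norm_le_exp_of_re_pos
    (h := fun z => inner ℂ (restrictProj μ hE g)
      ((spectralResolution L).complexHeat z (restrictProj μ hF f)))
    (κ := a / 8 * D ^ (m / (m - 1))) (α := 1 / (m - 1))
    (C := complexTimeConst A n b a * ‖g‖ * ‖f‖) (by positivity) hα1 (by positivity)
    (fun z hz => differentiableAt_inner_complexHeat hsp _ _ hz) ?_ ?_ hz
  · refine key.trans (le_of_eq ?_)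
    rw [hpα]
    congr 3
    field_simp
    ring
  · intro z hz
    refine (norm_inner_le_norm _ _).trans ?_
    have h1 := ((spectralResolution L).complexHeat z).le_of_opNorm_le
      (norm_complexHeat_le hsp hz.le) (restrictProj μ hF f)
    calc _ ≤ ‖g‖ * (2 * ‖f‖) := by
          refine mul_le_mul (hnE g) (h1.trans ?_) (norm_nonneg _) (norm_nonneg _)
          gcongr
          exact hnF f
      _ = 2 * ‖g‖ * ‖f‖ := by ring
      _ ≤ complexTimeConst A n b a * ‖g‖ * ‖f‖ := by
          gcongr
          exact le_max_left _ _
  · intro t ht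
    have hρ : 0 < t ^ (1 / m) := Real.rpow_pos_of_pos ht _
    have h1 := h.norm_restrictProj_mul_le hA ha hb hρ hp1 hp2 (hDG t ht) hE hF hR hEb hFb hD0 hD
    have h2 : (D / t ^ (1 / m)) ^ (m / (m - 1)) = D ^ (m / (m - 1)) * t ^ (-(1 / (m - 1))) := by
      rw [Real.div_rpow hD0 hρ.le, ← Real.rpow_mul ht.le, Real.rpow_neg ht.le, ← div_eq_mul_inv]
      congr 2
      field_simp
    rw [h2, heatSemigroup_eq_complexHeat] at h1
    rw [inner_restrictProj_left]
    refine (norm_inner_le_norm _ _).trans ?_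
    have h3 := (restrictProj μ hE * (spectralResolution L).complexHeat t *
      restrictProj μ hF).le_of_opNorm_le h1 f
    rw [mul_apply_eq_comp, mul_apply_eq_comp] at h3
    calc _ ≤ ‖g‖ * (b * Real.exp (5 * a / 2) * separatedExpSum A n (a / 2) *
            Real.exp (-(a / 8 * (D ^ (m / (m - 1)) * t ^ (-(1 / (m - 1)))))) * ‖f‖) :=
          mul_le_mul_of_nonneg_left h3 (norm_nonneg _)
      _ = b * Real.exp (5 * a / 2) * separatedExpSum A n (a / 2) * ‖g‖ * ‖f‖ *
            Real.exp (-(a / 8 * D ^ (m / (m - 1)) * t ^ (-(1 / (m - 1))))) := by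
          rw [← mul_assoc (a / 8)]; ring
      _ ≤ _ := by
          gcongr
          exact le_max_right _ _

/-- Scaling in the exponent of the complex-time estimate: at `z = τ (1 - i (t/τ + 2πξ))` the
natural length is `τ^{-1/p} (1 + |t|)`, up to a power of `1 + |ξ|`. -/
theorem rpow_div_le_rpow_mul_div {p τ t ξ D : ℝ} (hp : 1 ≤ p) (hτ : 0 < τ) (hτ1 : τ ≤ 1)
    (hD : 0 ≤ D) {z : ℂ} (hz : z = ⟨τ, -(t + 2 * Real.pi * (τ * ξ))⟩) :
    (D / (τ ^ (-(1 / p)) * (1 + |t|)) / (7 * (1 + |ξ|))) ^ p ≤ D ^ p * z.re / ‖z‖ ^ p := by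
  have hp0 : 0 < p := by linarith
  have hz0 : 0 < ‖z‖ := norm_pos_iff.2 fun h0 => by
    rw [hz] at h0
    exact hτ.ne' (congrArg Complex.re h0)
  have hzn : ‖z‖ ≤ 7 * (1 + |ξ|) * (1 + |t|) := by
    have h1 := Complex.norm_le_abs_re_add_abs_im z
    have h2 : |z.re| = τ := by rw [hz]; exact abs_of_pos hτ
    have h3 : |z.im| ≤ |t| + 2 * Real.pi * (τ * |ξ|) := by
      rw [hz]
      simp only [abs_neg]
      refine (abs_add_le _ _).trans (le_of_eq ?_)
      rw [abs_mul, abs_mul, abs_mul, abs_two, abs_of_pos Real.pi_pos, abs_of_pos hτ]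
    have h4 : 2 * Real.pi * (τ * |ξ|) ≤ 7 * |ξ| := by
      have := Real.pi_lt_d2
      have h5 : τ * |ξ| ≤ |ξ| := mul_le_of_le_one_left (abs_nonneg _) hτ1
      nlinarith [abs_nonneg ξ, Real.pi_pos]
    nlinarith [abs_nonneg ξ, abs_nonneg t, mul_nonneg (abs_nonneg ξ) (abs_nonneg t)]
  have hre : z.re = τ := by rw [hz]
  have hτp : (τ ^ (-(1 / p))) ^ p = τ⁻¹ := by
    rw [← Real.rpow_mul hτ.le, neg_mul, one_div_mul_cancel hp0.ne', Real.rpow_neg_one]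
  have hτp0 : 0 < τ ^ (-(1 / p)) := Real.rpow_pos_of_pos hτ _
  have e : D / (τ ^ (-(1 / p)) * (1 + |t|)) / (7 * (1 + |ξ|))
      = D / (τ ^ (-(1 / p)) * (7 * (1 + |ξ|) * (1 + |t|))) := by
    rw [div_div]; ring_nf
  rw [e, Real.div_rpow hD (by positivity), Real.mul_rpow hτp0.le (by positivity), hτp, hre]
  have h6 : ‖z‖ ^ p ≤ (7 * (1 + |ξ|) * (1 + |t|)) ^ p := Real.rpow_le_rpow hz0.le hzn hp0.le
  have h7 : 0 < ‖z‖ ^ p := Real.rpow_pos_of_pos hz0 _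
  calc D ^ p / (τ⁻¹ * (7 * (1 + |ξ|) * (1 + |t|)) ^ p)
      ≤ D ^ p / (τ⁻¹ * ‖z‖ ^ p) := by gcongr
    _ = D ^ p * τ / ‖z‖ ^ p := by field_simp

/-- The off-diagonal estimate for the multipliers `e^{-σ'λ} e^{itλ} φ(τλ)`, uniformly in
`σ' ≥ 0`. -/
theorem exists_norm_restrictProj_multiplier_le {m n A b a : ℝ} {φ : ℝ → ℂ} (hm : 2 ≤ m)
    (hA : 0 ≤ A) (hb : 0 ≤ b) (ha : 0 < a) (hφ : ContDiff ℝ ((⊤ : ℕ∞) : WithTop ℕ∞) φ)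
    (hsupp : tsupport φ ⊆ Icc (1 / 4) 4) (N : ℕ) :
    ∃ C : ℝ, 0 ≤ C ∧ ∀ (X : Type u) [MetricSpace X] [MeasurableSpace X] [BorelSpace X]
      (μ : Measure X) (L : Lp ℂ 2 μ →ₗ.[ℂ] Lp ℂ 2 μ),
      IsHomogeneousType μ n A → IsNonnegOperator L → DaviesGaffney μ L m b a →
      ∀ {E F : Set X} (hE : MeasurableSet E) (hF : MeasurableSet F) (x₀ : X) (R : ℝ), 0 ≤ R →
      E ⊆ Metric.ball x₀ R → F ⊆ Metric.ball x₀ R → ∀ D : ℝ, 0 ≤ D →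
      (∀ x ∈ E, ∀ y ∈ F, D ≤ dist x y) → ∀ s t τ : ℝ, 0 ≤ s → 0 < τ → τ ≤ 1 →
      ∀ T, (spectralResolution L).Represents
        (fun l => Complex.exp (-((s : ℂ) * l)) * Complex.exp (Complex.I * (t * l : ℝ)) * φ (τ * l)) T →
      ‖restrictProj μ hE * T * restrictProj μ hF‖ ≤
        C / (1 + D / (τ ^ (-(1 / (m / (m - 1)))) * (1 + |t|))) ^ N := by
  have hm1 : 0 < m - 1 := by linarith
  have hp1 : 1 ≤ m / (m - 1) := by rw [le_div_iff₀ hm1]; linarith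
  set p := m / (m - 1) with hp
  obtain ⟨κ, hκ⟩ : ∃ κ, κ = a / (16 * (m - 1)) := ⟨_, rfl⟩
  have hκ0 : 0 < κ := by rw [hκ]; positivity
  obtain ⟨C₁, hC₁, h₁⟩ := exists_fourier_superposition hφ hsupp N
  obtain ⟨C₂, hC₂, h₂⟩ := exists_exp_neg_rpow_mul_pow_le hκ0 hp1 N
  set C₃ := complexTimeConst A n b a with hC₃def
  have hC₃ : 0 ≤ C₃ := le_trans zero_le_two (le_max_left _ _)
  refine ⟨C₃ * (C₂ * 7 ^ N) * C₁, by positivity, ?_⟩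
  intro X _ _ _ μ L h hL hDG E F hE hF x₀ R hR hEb hFb D hD0 hD s t τ hs hτ hτ1 T hT
  have hsp := spectralResolution_proj_Iio_zero hL
  obtain ⟨w, hw, hwN, hwC, hw_eq⟩ := h₁ (s / τ) (by positivity)
  set x := D / (τ ^ (-(1 / p)) * (1 + |t|)) with hx
  have hx0 : 0 ≤ x := by positivity
  let z : ℝ → ℂ := fun ξ => ⟨τ, -(t + 2 * Real.pi * (τ * ξ))⟩
  have hzre : ∀ ξ, (z ξ).re = τ := fun ξ => rfl
  have hzmeas : Measurable z := by
    have : z = fun ξ : ℝ => (τ : ℂ) + ((-(t + 2 * Real.pi * (τ * ξ)) : ℝ) : ℂ) * Complex.I := by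
      funext ξ
      exact Complex.mk_eq_add_mul_I _ _
    rw [this]
    fun_prop
  have hdecay : ∀ ξ, Real.exp (-(κ * (D ^ p * (z ξ).re / ‖z ξ‖ ^ p))) ≤
      C₂ * 7 ^ N / (1 + x) ^ N * (1 + |ξ|) ^ N := by
    intro ξ
    have h3 := rpow_div_le_rpow_mul_div (t := t) (ξ := ξ) hp1 hτ hτ1 hD0 (z := z ξ) rfl
    rw [← hx] at h3
    have hy : 0 < 7 * (1 + |ξ|) := by positivity
    have h4 := h₂ (x / (7 * (1 + |ξ|))) (by positivity)
    have h5 : (1 + x) / (7 * (1 + |ξ|)) ≤ 1 + x / (7 * (1 + |ξ|)) := by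
      rw [add_div]
      gcongr
      rw [div_le_one hy]
      linarith [abs_nonneg ξ]
    calc Real.exp (-(κ * (D ^ p * (z ξ).re / ‖z ξ‖ ^ p)))
        ≤ Real.exp (-(κ * (x / (7 * (1 + |ξ|))) ^ p)) := by gcongr
      _ ≤ C₂ * 7 ^ N / (1 + x) ^ N * (1 + |ξ|) ^ N := by
        have h6 : Real.exp (-(κ * (x / (7 * (1 + |ξ|))) ^ p)) * ((1 + x) / (7 * (1 + |ξ|))) ^ N
            ≤ C₂ := le_trans (by gcongr) h4
        rw [div_pow, ← mul_div_assoc, div_le_iff₀ (by positivity), mul_pow] at h6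
        rw [div_mul_eq_mul_div, le_div_iff₀ (by positivity)]
        linarith
  have hrep : ∀ ξ, (spectralResolution L).Represents (fun l => Complex.exp (-(z ξ * l)))
      ((spectralResolution L).complexHeat (z ξ)) := fun ξ =>
    represents_complexHeat hsp (by rw [hzre]; exact hτ.le)
  have hsuper : ∀ l : ℝ, 0 ≤ l →
      Complex.exp (-((s : ℂ) * l)) * Complex.exp (Complex.I * (t * l : ℝ)) * φ (τ * l) =
        ∫ ξ, w ξ * Complex.exp (-(z ξ * l)) := by
    intro l _
    have h7 := hw_eq (τ * l)
    have h8 : Complex.exp (-((s : ℂ) * l)) * Complex.exp (Complex.I * (t * l : ℝ)) * φ (τ * l)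
        = Complex.exp (-(τ * l : ℝ) + Complex.I * (t * l : ℝ)) *
          (φ (τ * l) * Complex.exp (-(((s / τ - 1 : ℝ) : ℂ) * (τ * l : ℝ)))) := by
      rw [mul_comm _ (φ _), mul_left_comm (Complex.exp (-(τ * l : ℝ) + _)), ← Complex.exp_add,
        ← Complex.exp_add]
      congr 2
      have : (τ : ℂ) ≠ 0 := by exact_mod_cast hτ.ne'
      push_cast
      field_simp
      ring
    rw [h8, h7, ← integral_const_mul]
    refine integral_congr_ae (Filter.Eventually.of_forall fun ξ => ?_)
    simp only
    rw [mul_left_comm, ← Complex.exp_add]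
    congr 2
    apply Complex.ext <;> simp [z]
    ring
  have hmeas : Measurable (Function.uncurry fun ξ l : ℝ => Complex.exp (-(z ξ * l))) := by
    have h1 : Measurable fun q : ℝ × ℝ => z q.1 := hzmeas.comp measurable_fst
    simp only [Function.uncurry_def]
    fun_prop
  set B := C₃ * (C₂ * 7 ^ N) * C₁ / (1 + x) ^ N with hB
  have hB0 : 0 ≤ B := by positivity
  refine ContinuousLinearMap.opNorm_le_bound _ hB0 fun f => ?_
  set u := (restrictProj μ hE * T * restrictProj μ hF) f with hu
  have hinner : ‖inner ℂ u u‖ ≤ B * ‖u‖ * ‖f‖ := by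
    have h9 : inner ℂ u u = inner ℂ (restrictProj μ hE u) (T (restrictProj μ hF f)) := by
      rw [inner_restrictProj_left]
      rfl
    obtain ⟨-, h10⟩ := hT.inner_eq_integral hsp hw hmeas
      (fun ξ => norm_cexp_neg_mul_le (by rw [hzre]; exact hτ.le)) hrep hsuper
      (restrictProj μ hE u) (restrictProj μ hF f)
    rw [h9, h10]
    have h11 : B * ‖u‖ * ‖f‖ = C₃ * ‖u‖ * ‖f‖ * (C₂ * 7 ^ N / (1 + x) ^ N) * C₁ := by
      rw [hB]; ring
    rw [h11]
    refine le_trans (norm_integral_le_of_norm_le (hwN.const_mul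
      (C₃ * ‖u‖ * ‖f‖ * (C₂ * 7 ^ N / (1 + x) ^ N)))
      (Filter.Eventually.of_forall fun ξ => ?_)) ?_
    · have h12 := norm_inner_complexHeat_le h hA hm ha hb hL hDG hE hF hR hEb hFb hD0 hD u f
        (z := z ξ) (by rw [hzre]; exact hτ)
      rw [← hκ, ← hp, ← hC₃def] at h12
      rw [norm_mul]
      calc _ ≤ ‖w ξ‖ * (C₃ * ‖u‖ * ‖f‖ * (C₂ * 7 ^ N / (1 + x) ^ N * (1 + |ξ|) ^ N)) := by
            refine mul_le_mul_of_nonneg_left (h12.trans ?_) (norm_nonneg _)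
            exact mul_le_mul_of_nonneg_left (hdecay ξ) (by positivity)
        _ = _ := by ring
    · rw [integral_const_mul]
      exact mul_le_mul_of_nonneg_left hwC (by positivity)
  rw [inner_self_eq_norm_sq_to_K] at hinner
  have h13 : ‖((‖u‖ : ℂ)) ^ 2‖ = ‖u‖ * ‖u‖ := by
    rw [norm_pow, Complex.norm_real, norm_norm, sq]
  have h14 : ‖u‖ * ‖u‖ ≤ ‖u‖ * (B * ‖f‖) := by
    refine le_trans (le_of_eq h13.symm) (hinner.trans (le_of_eq (by ring)))
  rcases eq_or_lt_of_le (norm_nonneg u) with h0 | h0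
  · rw [← h0]; positivity
  · exact le_of_mul_le_mul_left h14 h0

theorem one_sub_pow_eq_sum_smul {R : Type*} [Ring R] [Algebra ℂ R] (e : R) (K : ℕ) :
    (1 - e) ^ K = ∑ j ∈ Finset.range (K + 1), ((-1) ^ j * (K.choose j : ℂ)) • e ^ j := by
  rw [sub_eq_neg_add, (Commute.one_right (-e)).add_pow]
  refine Finset.sum_congr rfl fun j _ => ?_
  rw [one_pow, mul_one, neg_pow, Algebra.smul_def, map_mul, map_pow, map_neg, map_one, map_natCast,
    mul_assoc, mul_assoc, Nat.cast_comm]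

end MainEstimate

theorem proposition2p3 (m n A b a M : ℝ) (K : ℕ) (φ : ℝ → ℂ)
    (hm : 2 ≤ m) (hn : 0 < n) (hA : 0 < A) (hb : 0 < b) (ha : 0 < a) (hM : 0 < M) (hK : 1 ≤ K)
    (hφ : ContDiff ℝ ((⊤ : ℕ∞) : WithTop ℕ∞) φ) (hφ_supp : tsupport φ ⊆ Set.Icc (1 / 4) 4) :
    ∃ C : ℝ, 0 < C ∧
      ∀ (X : Type u) [MetricSpace X] [MeasurableSpace X] [BorelSpace X] (μ : Measure X)
        (L : Lp ℂ 2 μ →ₗ.[ℂ] Lp ℂ 2 μ),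
        IsHomogeneousType μ n A → IsSelfAdjoint L → IsNonnegOperator L →
        DaviesGaffney μ L m b a →
        ∀ (s t : ℝ) (k : ℕ), 0 < s → 1 ≤ k →
        ∀ (c r : ℝ) (x₁ x₂ : X), 1 / 4 ≤ c →
          c * ((2 : ℝ) ^ ((m - 1) * k / m) * (1 + |t|)) ≤ r →
          ∀ f : Lp ℂ 2 μ,
            ‖ballProj μ x₁ r (((1 - heatSemigroup L s) ^ K * schrodingerGroup L t *
                borelCalc L (fun l => φ ((2 : ℝ) ^ (-(k : ℝ)) * l))) (ballProj μ x₂ r f))‖ ≤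
              C * (1 + setDist (Metric.ball x₁ r) (Metric.ball x₂ r) /
                ((2 : ℝ) ^ ((m - 1) * k / m) * (1 + |t|))) ^ (-M) * ‖ballProj μ x₂ r f‖ := by
  obtain ⟨C, hC0, hC⟩ := exists_norm_restrictProj_multiplier_le (n := n) hm hA.le hb.le ha hφ
    hφ_supp ⌈M⌉₊
  refine ⟨2 ^ K * C + 1, by positivity, ?_⟩
  intro X _ _ _ μ L h _ hL hDG s t k hs _ c r x₁ x₂ hc hr f
  have hsp := spectralResolution_proj_Iio_zero hL
  have hr0 : 0 < r := lt_of_lt_of_le (by positivity) hr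
  set S := (2 : ℝ) ^ ((m - 1) * k / m) * (1 + |t|) with hS
  set D := setDist (Metric.ball x₁ r) (Metric.ball x₂ r) with hDdef
  set τ := (2 : ℝ) ^ (-(k : ℝ)) with hτdef
  have hS0 : 0 < S := by positivity
  have hτ : 0 < τ := by positivity
  have hτ1 : τ ≤ 1 := Real.rpow_le_one_of_one_le_of_nonpos one_le_two (by simp)
  have hτS : τ ^ (-(1 / (m / (m - 1)))) * (1 + |t|) = S := by
    rw [hS, hτdef, ← Real.rpow_mul zero_le_two, one_div_div]
    congr 2
    ring
  have hD0 : 0 ≤ D := Real.sInf_nonneg (by rintro _ ⟨x, _, y, _, rfl⟩; exact dist_nonneg)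
  have hD : ∀ x ∈ Metric.ball x₁ r, ∀ y ∈ Metric.ball x₂ r, D ≤ dist x y := fun x hx y hy =>
    csInf_le ⟨0, by rintro _ ⟨x, _, y, _, rfl⟩; exact dist_nonneg⟩ ⟨x, hx, y, hy, rfl⟩
  obtain ⟨Bφ, hBφ⟩ := hφ.continuous.bounded_above_of_compact_support
    (isCompact_Icc.of_isClosed_subset (isClosed_tsupport φ) hφ_supp)
  set U := schrodingerGroup L t with hU
  set Φ := borelCalc L (fun l => φ (τ * l)) with hΦ
  have hφm : Measurable fun l => φ (τ * l) := by
    have := hφ.continuous.measurable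
    fun_prop
  have hUrep : (spectralResolution L).Represents
      (fun l => Complex.exp (Complex.I * (t * l : ℝ))) U :=
    ProjectionValuedMeasure.represents_integral hsp (by fun_prop) (B := 1) fun l _ => by
      rw [mul_comm, Complex.norm_exp_ofReal_mul_I]
  have hΦrep : (spectralResolution L).Represents (fun l => φ (τ * l)) Φ :=
    ProjectionValuedMeasure.represents_integral hsp hφm fun l _ => hBφ _
  have hterm : ∀ j : ℕ, ‖ballProj μ x₁ r * (heatSemigroup L s ^ j * U * Φ) * ballProj μ x₂ r‖ ≤
      C / (1 + D / S) ^ ⌈M⌉₊ := by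
    intro j
    have hjs : 0 ≤ (j : ℝ) * s := by positivity
    rw [heatSemigroup_eq_complexHeat, ProjectionValuedMeasure.complexHeat_pow hsp hs.le]
    have hrep := ((ProjectionValuedMeasure.represents_complexHeat hsp
      (z := ((j * s : ℝ) : ℂ)) (by rwa [Complex.ofReal_re])).mul hsp hUrep (by fun_prop)
      (by fun_prop) (ProjectionValuedMeasure.norm_cexp_neg_mul_le (by rwa [Complex.ofReal_re]))
      (D := 1) fun l _ => by rw [mul_comm, Complex.norm_exp_ofReal_mul_I]).mul hsp hΦrep
      (by fun_prop) hφm (B := 1) (fun l hl => by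
        rw [norm_mul, mul_comm Complex.I, Complex.norm_exp_ofReal_mul_I, mul_one]
        exact ProjectionValuedMeasure.norm_cexp_neg_mul_le (by rwa [Complex.ofReal_re]) l hl)
      (fun l _ => hBφ _)
    have := hC X μ L h hL hDG measurableSet_ball measurableSet_ball x₁ (r + dist x₂ x₁)
      (by positivity) (Metric.ball_subset_ball (by linarith [dist_nonneg (x := x₂) (y := x₁)]))
      (Metric.ball_subset_ball' le_rfl) D hD0 hD (j * s) t τ hjs hτ hτ1 _ hrep
    rwa [hτS] at this
  -- the binomial coefficients contribute the factor `2 ^ K`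
  have hop : ‖ballProj μ x₁ r * ((1 - heatSemigroup L s) ^ K * U * Φ) * ballProj μ x₂ r‖ ≤
      2 ^ K * (C / (1 + D / S) ^ ⌈M⌉₊) := by
    rw [one_sub_pow_eq_sum_smul]
    simp only [Finset.sum_mul, Finset.mul_sum, smul_mul_assoc, mul_smul_comm]
    refine (norm_sum_le _ _).trans ?_
    have h2 : ((2 : ℝ) ^ K) = ∑ j ∈ Finset.range (K + 1), (K.choose j : ℝ) := by
      exact_mod_cast (Nat.sum_range_choose K).symm
    rw [h2, Finset.sum_mul]
    refine Finset.sum_le_sum fun j _ => ?_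
    rw [norm_smul, norm_mul, norm_pow, norm_neg, norm_one, one_pow, one_mul, Complex.norm_natCast]
    exact mul_le_mul_of_nonneg_left (hterm j) (Nat.cast_nonneg _)
  have hpow : C / (1 + D / S) ^ ⌈M⌉₊ ≤ C * (1 + D / S) ^ (-M) := by
    rw [div_eq_mul_inv, ← Real.rpow_natCast, ← Real.rpow_neg (by positivity)]
    refine mul_le_mul_of_nonneg_left (Real.rpow_le_rpow_of_exponent_le ?_ ?_) hC0
    · have : 0 ≤ D / S := by positivity
      linarith
    · exact neg_le_neg (Nat.le_ceil M)
  have hidem : ballProj μ x₂ r (ballProj μ x₂ r f) = ballProj μ x₂ r f :=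
    congrArg (fun T : Lp ℂ 2 μ →L[ℂ] Lp ℂ 2 μ => T f)
      (restrictProj_mul_restrictProj measurableSet_ball measurableSet_ball Subset.rfl)
  have hfin := (ballProj μ x₁ r * ((1 - heatSemigroup L s) ^ K * U * Φ) *
    ballProj μ x₂ r).le_of_opNorm_le hop (ballProj μ x₂ r f)
  rw [mul_apply_eq_comp, mul_apply_eq_comp, hidem] at hfin
  refine hfin.trans (mul_le_mul_of_nonneg_right ?_ (norm_nonneg _))
  have hq : 0 ≤ (1 + D / S) ^ (-M) := by positivity
  calc 2 ^ K * (C / (1 + D / S) ^ ⌈M⌉₊) ≤ 2 ^ K * (C * (1 + D / S) ^ (-M)) := by gcongr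
    _ ≤ (2 ^ K * C + 1) * (1 + D / S) ^ (-M) := by nlinarith
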